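/- Let $C=\mathbb{Q}[\tau][z_k,\bar z_k\mid k>0]$, let $\varepsilon$ be a formal variable, and let $\widetilde{\mathcal A}$ be the $\varepsilon$-adically complete differential algebra over $C[[\varepsilon]]$ generated by $q,v,\bar v$ subject to the relation $\tau\,\partial q=q\,\nabla(v-\bar v)$; that is, $\widetilde{\mathcal A}$ is the quotient of $C[\partial^nq,\partial^nv,\partial^n\bar v\mid n\ge0][[\varepsilon]]$ by the $\varepsilon$-adically closed differential ideal generated by $\tau\,\partial q-q\,\nabla(v-\bar v)$, where $\partial$ is $C[[\varepsilon]]$-linear, so that $\tau,z_k,\bar z_k,\varepsilon$ are constants. Here $\mathsf E=e^{\varepsilon\partial}$, $\nabla=\varepsilon^{-1}(\mathsf E^{1/2}-\mathsf E^{-1/2})$ and $\mathsf P=\partial/\nabla=\varepsilon\partial/(\mathsf E^{1/2}-\mathsf E^{-1/2})$. Let $\Phi_-$ be the algebra of difference operators $\sum_kp_k\Lambda^k$, with $p_k\in\widetilde{\mathcal A}$ and $p_k=0$ for $k\gg0$, with product $$\sum_ia_i\Lambda^i\cdot\sum_jb_j\Lambda^j=\sum_k\Bigl(\sum_{i+j=k}(\mathsf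 E^{-j/2}a_i)(\mathsf E^{i/2}b_j)\Bigr)\Lambda^k .$$ Let $K=\Lambda+v+q\Lambda^{-1}$, and let $L=\Lambda+\sum_{k\ge1}a_k\Lambda^{1-k}\in\Phi_-$ be the Lax operator of the equivariant Toda lattice: $a_1=v$, and the remaining coefficients $a_2,a_3,\dots$ are determined recursively by the equations $$p_{-1}(k)-q\,p_1(k)-\tau\,\mathsf P\,p_0(k)=z_k\qquad(k\ge1),\qquad\text{where } L^k=\sum_jp_j(k)\Lambda^j .$$ Let $\Omega$ be the $\varepsilon$-adically completed module of Kähler differentials of $\widetilde{\mathcal A}$ relative to the ring of constants $C[[\varepsilon]]$ (so $d\tau=dz_k=d\bar z_k=0$), on which $\partial$ acts by $\partial(f\,dg)=\partial f\,dg+f\,d(\partial g)$. The above product formula also defines the product of an element of $\Phi_-$ with a series $\sum_k\omega_k\Lambda^k$, where $\omega_k\in\Omega$ and $\omega_k=0$ for $k\gg0$. Put $d(\sum_kp_k\Lambda^k)=\sum_kdp_k\,\Lambda^k$, and define $\operatorname{Res}(\sum_kf_k\Lambda^k)$ to be the class of $f_0$ in $\widetilde{\mathcal A}/\partial\widetilde{\mathcal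 A}$, and $\operatorname{Res}(\sum_k\omega_k\Lambda^k)$ to be the class of $\omega_0$ in $\Omega/\partial\Omega$; write $d$ also for the map $\widetilde{\mathcal A}/\partial\widetilde{\mathcal A}\to\Omega/\partial\Omega$ induced by $d$. Let $h_n=\frac1{n+1}\operatorname{Res}(L^{n+1})$ for $n\ge0$, let $h_{-1}=0$, and let $$H_n=h_n-\tau h_{n-1}+\sum_{k=1}^{n-1}z_kh_{n-k-1}\in\widetilde{\mathcal A}/\partial\widetilde{\mathcal A}\qquad(n\ge0).$$ Then, for every $n\ge0$, $$\operatorname{Res}(L^n\,dK)=dH_n\quad\text{in }\Omega/\partial\Omega .$$ -/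

import Mathlib

noncomputable section

namespace EquivariantToda

/-! ### The free differential algebra and its completion -/

/-- The constants: `τ`, `z_k` and `zbar_k` for `k > 0`. -/
inductive ConstVar : Type
  | tau : ConstVar
  | z (k : ℕ+) : ConstVar
  | zbar (k : ℕ+) : ConstVar

/-- The ring of constants `ℚ[τ][z_k, zbar_k | k > 0]` (before adjoining `ε`). -/
def Const : Type := MvPolynomial ConstVar ℚ

instance : CommRing Const := inferInstanceAs (CommRing (MvPolynomial ConstVar ℚ))
instance : Algebra ℚ Const := inferInstanceAs (Algebra ℚ (MvPolynomial ConstVar ℚ))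

/-- The constant `τ`. -/
def tau : Const := MvPolynomial.X ConstVar.tau

/-- The constant `z_k`, for `k > 0` (the value at `k = 0` is never used). -/
def z (k : ℕ) : Const := MvPolynomial.X (ConstVar.z k.toPNat')

/-- The differential generators `q`, `v` and `vbar`. -/
inductive Gen : Type
  | q : Gen
  | v : Gen
  | vbar : Gen

/-- The jet variables: `(x, n)` stands for `∂ⁿ x`. -/
abbrev Jet : Type := Gen × ℕ

/-- Differential polynomials in `q`, `v`, `vbar` over the constants. -/
def JetPoly : Type := MvPolynomial Jet Const

instance : CommRing JetPoly := inferInstanceAs (CommRing (MvPolynomial Jet Const))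
instance : Algebra Const JetPoly := inferInstanceAs (Algebra Const (MvPolynomial Jet Const))
instance : Algebra ℚ JetPoly := inferInstanceAs (Algebra ℚ (MvPolynomial Jet Const))
instance : IsScalarTower ℚ Const JetPoly :=
  inferInstanceAs (IsScalarTower ℚ Const (MvPolynomial Jet Const))

/-- The jet variable `∂ⁿ x`, as a differential polynomial. -/
def jetVar (x : Jet) : JetPoly := (MvPolynomial.X x : MvPolynomial Jet Const)

/-- The `ε`-adically complete free differential algebra
`ℚ[τ, z_k, zbar_k]{q, v, vbar}[[ε]]`; the power series variable is `ε`. -/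
abbrev JetSeries : Type := PowerSeries JetPoly

/-- The derivation `∂` of the differential polynomials: `∂(∂ⁿ x) = ∂ⁿ⁺¹ x`. -/
def jetDer : Derivation Const JetPoly JetPoly :=
  (MvPolynomial.mkDerivation Const fun x => MvPolynomial.X (x.1, x.2 + 1) :
    Derivation Const (MvPolynomial Jet Const) (MvPolynomial Jet Const))

/-- The partial derivative with respect to a jet variable. -/
def jetPderiv (x : Jet) : Derivation Const JetPoly JetPoly :=
  (MvPolynomial.pderiv x : Derivation Const (MvPolynomial Jet Const) (MvPolynomial Jet Const))

theorem finite_jetPderiv_ne_zero (f : JetPoly) : {x | jetPderiv x f ≠ 0}.Finite := by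
  refine (MvPolynomial.vars (R := Const) (σ := Jet) f).finite_toSet.subset fun x hx => ?_
  by_contra h
  exact hx (MvPolynomial.pderiv_eq_zero_of_notMem_vars h)

/-- The derivation `∂` of `JetSeries`, with `∂ ε = 0`. -/
def seriesDer : JetSeries →ₗ[Const] JetSeries where
  toFun f := PowerSeries.mk fun n => jetDer (PowerSeries.coeff n f)
  map_add' f g := by ext1 n; simp
  map_smul' c f := by ext1 n; simp

/-- The operator `φ(ε∂) = ∑ φ_i εⁱ ∂ⁱ` on `JetSeries`, for `φ ∈ ℚ[[x]]`. -/
def seriesOp (φ : PowerSeries ℚ) : JetSeries →ₗ[Const] JetSeries where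
  toFun f := PowerSeries.mk fun n => ∑ i ∈ Finset.range (n + 1),
    PowerSeries.coeff i φ • PowerSeries.coeff (n - i) ((seriesDer ^ i) f)
  map_add' f g := by ext1 n; simp [Finset.sum_add_distrib]
  map_smul' c f := by
    ext1 n
    simp only [map_smul, PowerSeries.coeff_mk, PowerSeries.coeff_smul, RingHom.id_apply,
      Finset.smul_sum]
    exact Finset.sum_congr rfl fun p _ => smul_comm _ _ _

/-! ### The symbols of the operators -/

/-- The symbol `exp (s x)` of `E^s`, where `E = exp (ε∂)`. -/
def expSymbol (s : ℚ) : PowerSeries ℚ := PowerSeries.mk fun n => s ^ n / n.factorial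

/-- The symbol `(exp (x/2) - exp (-x/2)) / x` of the operator `∇ / ∂`,
where `∇ = ε⁻¹ (E^{1/2} - E^{-1/2})`. -/
def nablaSymbol : PowerSeries ℚ :=
  PowerSeries.mk fun n => PowerSeries.coeff (n + 1) (expSymbol (1 / 2) - expSymbol (-1 / 2))

/-- The symbol of the operator `P = ∂ / ∇`. -/
def pSymbol : PowerSeries ℚ := nablaSymbol⁻¹

/-- The symbol of `[k] = (E^{k/2} - E^{-k/2}) / (E^{1/2} - E^{-1/2}) = ∑_{j=1}^k E^{(k+1)/2-j}`. -/
def bracketSymbol (k : ℕ) : PowerSeries ℚ :=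
  ∑ j ∈ Finset.Icc 1 k, expSymbol (((k : ℚ) + 1) / 2 - j)

/-! ### The differential algebra of the equivariant Toda lattice -/

/-- The generator `x` as an element of `JetSeries`. -/
def gen (x : Gen) : JetSeries := PowerSeries.C (jetVar (x, 0))

/-- The element `τ ∂q - q ∇(v - vbar)`. -/
def relator : JetSeries :=
  tau • seriesDer (gen Gen.q) -
    gen Gen.q * seriesOp nablaSymbol (seriesDer (gen Gen.v - gen Gen.vbar))

/-- The differential ideal generated by `τ ∂q - q ∇(v - vbar)`. -/
def relIdeal₀ : Ideal JetSeries :=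
  Ideal.span (Set.range fun n : ℕ => (seriesDer ^ n) relator)

/-- The closure of `relIdeal₀` in the `ε`-adic topology. -/
def relIdeal : Ideal JetSeries :=
  ⨅ N : ℕ, relIdeal₀ ⊔ Ideal.span {(PowerSeries.X : JetSeries) ^ N}

/-- The (`ε`-adically complete) differential algebra of the equivariant Toda lattice,
`ℚ_{ε,τ}[z_k, zbar_k | k > 0]{q, v, vbar} / (τ ∂q - q ∇(v - vbar))`. -/
def Toda : Type := JetSeries ⧸ relIdeal

instance : CommRing Toda := inferInstanceAs (CommRing (JetSeries ⧸ relIdeal))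
instance : Algebra Const Toda := inferInstanceAs (Algebra Const (JetSeries ⧸ relIdeal))

/-! ### Differential forms

All differentials are relative to the constants: `dε = dτ = dz_k = dzbar_k = 0`. -/

/-- The `ε`-adically completed module of Kähler differentials of `JetSeries`: the completed free
module with basis `d(∂ⁿ x)`; its elements are families of coefficients `ω x` such that each power
of `ε` occurs with a nonzero coefficient in only finitely many of them. -/
def formsFree : Submodule JetSeries (Jet → JetSeries) where
  carrier := {ω | ∀ n, {x | PowerSeries.coeff n (ω x) ≠ 0}.Finite}
  zero_mem' n := by simp
  add_mem' {a b} ha hb n := by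
    refine ((ha n).union (hb n)).subset fun x hx => ?_
    by_contra h
    simp only [Set.mem_union, Set.mem_ofPred_eq, not_or, not_not] at h
    exact hx (by simp [h.1, h.2])
  smul_mem' f a ha n := by
    refine ((Finset.range (n + 1)).finite_toSet.biUnion fun i _ => ha i).subset fun x hx => ?_
    by_contra h
    simp only [Set.mem_iUnion, not_exists, Set.mem_ofPred_eq, not_not] at h
    refine hx ?_
    simp only [Pi.smul_apply, smul_eq_mul, PowerSeries.coeff_mul]
    refine Finset.sum_eq_zero fun p hp => ?_
    rw [Finset.HasAntidiagonal.mem_antidiagonal] at hp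
    rw [h p.2 (by simp; omega), mul_zero]

/-- The universal differential `d f = ∑ (∂f/∂x) dx` on `JetSeries`. -/
def seriesD : JetSeries →ₗ[Const] formsFree where
  toFun f := ⟨fun x => PowerSeries.mk fun n => jetPderiv x (PowerSeries.coeff n f), by
    intro n
    simpa using finite_jetPderiv_ne_zero (PowerSeries.coeff n f)⟩
  map_add' f g := by ext x n : 3; simp
  map_smul' c f := by ext x n : 3; simp

/-- The coefficients of `∂ω`, where `∂(f d(∂ⁿ x)) = ∂f d(∂ⁿ x) + f d(∂ⁿ⁺¹ x)`. -/
def formsDerFun (ω : Jet → JetSeries) : Jet → JetSeries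
  | (g, 0) => seriesDer (ω (g, 0))
  | (g, n + 1) => seriesDer (ω (g, n + 1)) + ω (g, n)

/-- The action of `∂` on the free module of differentials. -/
def formsDer : formsFree →ₗ[Const] formsFree where
  toFun ω := ⟨formsDerFun ω.1, by
    intro n
    refine ((ω.2 n).union ((ω.2 n).image fun x => (x.1, x.2 + 1))).subset ?_
    rintro ⟨g, k⟩ hx
    by_contra h
    simp only [Set.mem_union, Set.mem_image, not_or, not_exists, not_and] at h
    obtain ⟨h1, h2⟩ := h
    simp only [Set.mem_ofPred_eq, not_not] at h1
    refine hx ?_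
    cases k with
    | zero => simp [formsDerFun, seriesDer, h1]
    | succ k =>
      have h3 : PowerSeries.coeff n (ω.1 (g, k)) = 0 := by
        by_contra h3
        exact h2 (g, k) h3 rfl
      simp [formsDerFun, seriesDer, h1, h3]⟩
  map_add' a b := by
    ext x n : 3
    obtain ⟨g, k⟩ := x
    cases k <;> simp [formsDerFun]
    ring
  map_smul' c a := by
    ext x n : 3
    obtain ⟨g, k⟩ := x
    cases k <;> simp [formsDerFun]

/-- The operator `φ(ε∂) = ∑ φ_i εⁱ ∂ⁱ` on the free module of differentials. -/
def formsOp (φ : PowerSeries ℚ) : formsFree →ₗ[Const] formsFree where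
  toFun ω := ⟨fun x => PowerSeries.mk fun n => ∑ i ∈ Finset.range (n + 1),
      PowerSeries.coeff i φ • PowerSeries.coeff (n - i) (((formsDer ^ i) ω).1 x), by
    intro n
    refine ((Finset.range (n + 1)).finite_toSet.biUnion
      fun i _ => ((formsDer ^ i) ω).2 (n - i)).subset fun x hx => ?_
    by_contra h
    simp only [Set.mem_iUnion, not_exists, Set.mem_ofPred_eq, not_not] at h
    refine hx ?_
    rw [PowerSeries.coeff_mk]
    exact Finset.sum_eq_zero fun i hi => by rw [h i hi, smul_zero]⟩
  map_add' f g := by ext x n : 3; simp [Finset.sum_add_distrib]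
  map_smul' c f := by
    ext x n : 3
    have h : ∀ (c : Const) (f : formsFree) (x : Jet) (n : ℕ),
        PowerSeries.coeff n ((c • f).1 x) = c • PowerSeries.coeff n (f.1 x) := fun _ _ _ _ => rfl
    rw [RingHom.id_apply, h]
    simp only [map_smul, h, PowerSeries.coeff_mk, Finset.smul_sum]
    exact Finset.sum_congr rfl fun p _ => smul_comm _ _ _

/-- The closure, in the `ε`-adic topology, of the submodule generated by `g ω` and `d g`
for `g` in the ideal of relations. -/
def formsRel : Submodule JetSeries formsFree :=
  ⨅ N : ℕ, relIdeal • ⊤ ⊔ Submodule.span JetSeries (seriesD '' relIdeal) ⊔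
    Ideal.span {(PowerSeries.X : JetSeries) ^ N} • ⊤

/-- The (`ε`-adically completed) module `Ω` of Kähler differentials of `Toda` over the ring of
constants: for a quotient by an ideal `J`, the differentials are those of the free algebra modulo
`J Ω` and `dJ`. -/
def Forms : Type := formsFree ⧸ formsRel

instance : AddCommGroup Forms := inferInstanceAs (AddCommGroup (formsFree ⧸ formsRel))
instance : Module Const Forms := inferInstanceAs (Module Const (formsFree ⧸ formsRel))

/-! ### The operators descend to the quotients -/

theorem seriesDer_mul (f g : JetSeries) :
    seriesDer (f * g) = seriesDer f * g + f * seriesDer g := by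
  ext1 n
  simp only [seriesDer, LinearMap.coe_mk, AddHom.coe_mk, PowerSeries.coeff_mk, map_add,
    PowerSeries.coeff_mul, map_sum, Derivation.leibniz, smul_eq_mul, Finset.sum_add_distrib]
  rw [add_comm]
  congr 1
  exact Finset.sum_congr rfl fun p _ => mul_comm _ _

theorem coeff_seriesDer (n : ℕ) (f : JetSeries) :
    PowerSeries.coeff n (seriesDer f) = jetDer (PowerSeries.coeff n f) := by
  simp [seriesDer]

theorem seriesDer_X_pow (N : ℕ) : seriesDer (PowerSeries.X ^ N) = 0 := by
  ext1 n
  rw [coeff_seriesDer, PowerSeries.coeff_X_pow]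
  split_ifs <;> simp

theorem coeff_seriesD (n : ℕ) (f : JetSeries) (x : Jet) :
    PowerSeries.coeff n ((seriesD f).1 x) = jetPderiv x (PowerSeries.coeff n f) := by
  simp [seriesD]

theorem seriesD_mul (f g : JetSeries) : seriesD (f * g) = f • seriesD g + g • seriesD f := by
  ext x n : 3
  rw [coeff_seriesD]
  have h : ((f • seriesD g + g • seriesD f : formsFree).1 x) =
    f * (seriesD g).1 x + g * (seriesD f).1 x := rfl
  rw [h, map_add, mul_comm g]
  simp only [PowerSeries.coeff_mul, coeff_seriesD, map_sum, Derivation.leibniz, smul_eq_mul,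
    Finset.sum_add_distrib]
  congr 1
  exact Finset.sum_congr rfl fun p _ => mul_comm _ _

theorem formsDer_smul (f : JetSeries) (ω : formsFree) :
    formsDer (f • ω) = seriesDer f • ω + f • formsDer ω := by
  ext1
  funext x
  obtain ⟨g, k⟩ := x
  cases k with
  | zero => exact seriesDer_mul f (ω.1 (g, 0))
  | succ k =>
    change seriesDer (f * ω.1 (g, k + 1)) + f * ω.1 (g, k) =
      seriesDer f * ω.1 (g, k + 1) + f * (seriesDer (ω.1 (g, k + 1)) + ω.1 (g, k))
    rw [seriesDer_mul]
    ring

theorem pderiv_shift_zero {C : Type} [CommRing C] (g : Gen) (f : MvPolynomial Jet C) :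
    MvPolynomial.pderiv (R := C) ((g, 0) : Jet)
      (MvPolynomial.mkDerivation C (fun x : Jet => MvPolynomial.X (x.1, x.2 + 1)) f) =
    MvPolynomial.mkDerivation C (fun x : Jet => MvPolynomial.X (x.1, x.2 + 1))
      (MvPolynomial.pderiv (R := C) ((g, 0) : Jet) f) := by
  classical
  have h : ⁅MvPolynomial.pderiv (R := C) ((g, 0) : Jet),
      MvPolynomial.mkDerivation C (fun x : Jet => MvPolynomial.X (x.1, x.2 + 1))⁆ =
        (0 : Derivation C (MvPolynomial Jet C) (MvPolynomial Jet C)) := by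
    refine MvPolynomial.derivation_ext fun i => ?_
    obtain ⟨i, j⟩ := i
    rw [Derivation.commutator_apply]
    by_cases hi : (i, j) = (g, 0) <;>
      simp [MvPolynomial.pderiv_X, hi, Prod.ext_iff]
  have := congrArg (fun D => D f) h
  simpa [Derivation.commutator_apply, sub_eq_zero] using this

theorem pderiv_shift_succ {C : Type} [CommRing C] (g : Gen) (k : ℕ) (f : MvPolynomial Jet C) :
    MvPolynomial.pderiv (g, k + 1)
      (MvPolynomial.mkDerivation C (fun x : Jet => MvPolynomial.X (x.1, x.2 + 1)) f) =
    MvPolynomial.mkDerivation C (fun x : Jet => MvPolynomial.X (x.1, x.2 + 1))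
      (MvPolynomial.pderiv (g, k + 1) f) + MvPolynomial.pderiv (g, k) f := by
  classical
  have h : ⁅MvPolynomial.pderiv (R := C) ((g, k + 1) : Jet),
      MvPolynomial.mkDerivation C (fun x : Jet => MvPolynomial.X (x.1, x.2 + 1))⁆ =
      MvPolynomial.pderiv (g, k) := by
    refine MvPolynomial.derivation_ext fun i => ?_
    obtain ⟨i, j⟩ := i
    rw [Derivation.commutator_apply]
    by_cases hi : (i, j) = (g, k + 1) <;> by_cases hj : (i, j) = (g, k) <;>
      simp_all [MvPolynomial.pderiv_X, Prod.ext_iff]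
  have := congrArg (fun D => D f) h
  simp only [Derivation.commutator_apply] at this
  rw [← this]
  ring

theorem formsDer_seriesD (f : JetSeries) : formsDer (seriesD f) = seriesD (seriesDer f) := by
  ext x n : 3
  rw [coeff_seriesD, coeff_seriesDer]
  obtain ⟨g, k⟩ := x
  cases k with
  | zero =>
    have h : (formsDer (seriesD f)).1 (g, 0) = seriesDer ((seriesD f).1 (g, 0)) := rfl
    rw [h, coeff_seriesDer, coeff_seriesD]
    exact (pderiv_shift_zero (C := Const) g _).symm
  | succ k =>
    have h : (formsDer (seriesD f)).1 (g, k + 1) =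
      seriesDer ((seriesD f).1 (g, k + 1)) + (seriesD f).1 (g, k) := rfl
    rw [h, map_add, coeff_seriesDer, coeff_seriesD, coeff_seriesD]
    exact (pderiv_shift_succ (C := Const) g k _).symm

theorem seriesDer_mem_relIdeal₀ {f : JetSeries} (hf : f ∈ relIdeal₀) :
    seriesDer f ∈ relIdeal₀ := by
  refine Submodule.span_induction ?_ ?_ ?_ ?_ hf
  · rintro _ ⟨n, rfl⟩
    refine Ideal.subset_span ⟨n + 1, ?_⟩
    simp only [pow_succ', Module.End.mul_apply]
  · simp
  · intro x y _ _ hx hy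
    rw [map_add]
    exact add_mem hx hy
  · intro a x hx' hx
    rw [smul_eq_mul, seriesDer_mul]
    exact add_mem (Ideal.mul_mem_left _ _ hx') (Ideal.mul_mem_left _ _ hx)

theorem seriesDer_mem_span_X_pow (N : ℕ) {f : JetSeries}
    (hf : f ∈ Ideal.span {(PowerSeries.X : JetSeries) ^ N}) :
    seriesDer f ∈ Ideal.span {(PowerSeries.X : JetSeries) ^ N} := by
  obtain ⟨g, rfl⟩ := Ideal.mem_span_singleton.1 hf
  rw [seriesDer_mul, seriesDer_X_pow, zero_mul, zero_add]
  exact Ideal.mul_mem_right _ _ (Ideal.mem_span_singleton_self _)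

theorem seriesDer_mem_relIdeal {f : JetSeries} (hf : f ∈ relIdeal) : seriesDer f ∈ relIdeal := by
  rw [relIdeal, Submodule.mem_iInf] at hf ⊢
  intro N
  obtain ⟨a, ha, b, hb, rfl⟩ := Submodule.mem_sup.1 (hf N)
  rw [map_add]
  exact Submodule.add_mem_sup (seriesDer_mem_relIdeal₀ ha) (seriesDer_mem_span_X_pow N hb)

theorem seriesOp_sub_mem (φ : PowerSeries ℚ) (N : ℕ) (f : JetSeries) :
    seriesOp φ f - ∑ i ∈ Finset.range N,
      (PowerSeries.X : JetSeries) ^ i * (PowerSeries.coeff i φ • (seriesDer ^ i) f) ∈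
      Ideal.span {(PowerSeries.X : JetSeries) ^ N} := by
  rw [Ideal.mem_span_singleton, PowerSeries.X_pow_dvd_iff]
  intro n hn
  rw [map_sub, map_sum, sub_eq_zero]
  simp only [PowerSeries.coeff_X_pow_mul']
  rw [← Finset.sum_filter]
  have h : {i ∈ Finset.range N | i ≤ n} = Finset.range (n + 1) := by
    ext i
    simp
    omega
  rw [h]
  simp [seriesOp]

theorem seriesOp_mem_relIdeal (φ : PowerSeries ℚ) {f : JetSeries} (hf : f ∈ relIdeal) :
    seriesOp φ f ∈ relIdeal := by
  have hi : ∀ i : ℕ, (seriesDer ^ i) f ∈ relIdeal := by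
    intro i
    induction i with
    | zero => simpa using hf
    | succ i ih =>
      rw [pow_succ', Module.End.mul_apply]
      exact seriesDer_mem_relIdeal ih
  rw [relIdeal, Submodule.mem_iInf]
  intro N
  rw [← sub_add_cancel (seriesOp φ f) (∑ i ∈ Finset.range N,
      (PowerSeries.X : JetSeries) ^ i * (PowerSeries.coeff i φ • (seriesDer ^ i) f))]
  refine add_mem (Submodule.mem_sup_right (seriesOp_sub_mem φ N f)) ?_
  refine Submodule.sum_mem _ fun i _ => Ideal.mul_mem_left _ _ ?_
  exact Submodule.smul_of_tower_mem _ _ ((iInf_le (fun N : ℕ =>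
    relIdeal₀ ⊔ Ideal.span {(PowerSeries.X : JetSeries) ^ N}) N) (hi i))

theorem formsDer_mem_ideal_smul (I : Ideal JetSeries) (hI : ∀ f ∈ I, seriesDer f ∈ I)
    {ω : formsFree} (hω : ω ∈ I • (⊤ : Submodule JetSeries formsFree)) :
    formsDer ω ∈ I • (⊤ : Submodule JetSeries formsFree) := by
  refine Submodule.smul_induction_on hω ?_ ?_
  · intro r hr n _
    rw [formsDer_smul]
    exact add_mem (Submodule.smul_mem_smul (hI r hr) trivial) (Submodule.smul_mem_smul hr trivial)
  · intro x y hx hy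
    rw [map_add]
    exact add_mem hx hy

theorem formsDer_mem_span {ω : formsFree}
    (hω : ω ∈ Submodule.span JetSeries (seriesD '' relIdeal)) :
    formsDer ω ∈ Submodule.span JetSeries (seriesD '' relIdeal) := by
  refine Submodule.span_induction ?_ ?_ ?_ ?_ hω
  · rintro _ ⟨f, hf, rfl⟩
    rw [formsDer_seriesD]
    exact Submodule.subset_span ⟨_, seriesDer_mem_relIdeal hf, rfl⟩
  · simp
  · intro x y _ _ hx hy
    rw [map_add]
    exact add_mem hx hy
  · intro a x hx' hx
    rw [formsDer_smul]
    exact add_mem (Submodule.smul_mem _ _ hx') (Submodule.smul_mem _ _ hx)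

theorem formsDer_mem_formsRel {ω : formsFree} (hω : ω ∈ formsRel) : formsDer ω ∈ formsRel := by
  rw [formsRel, Submodule.mem_iInf] at hω ⊢
  intro N
  obtain ⟨a', ha', b, hb, rfl⟩ := Submodule.mem_sup.1 (hω N)
  obtain ⟨a, ha, c, hc, rfl⟩ := Submodule.mem_sup.1 ha'
  rw [map_add, map_add]
  exact Submodule.add_mem_sup (Submodule.add_mem_sup
    (formsDer_mem_ideal_smul _ (fun _ => seriesDer_mem_relIdeal) ha) (formsDer_mem_span hc))
    (formsDer_mem_ideal_smul _ (fun _ => seriesDer_mem_span_X_pow N) hb)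

theorem formsOp_sub_mem (φ : PowerSeries ℚ) (N : ℕ) (ω : formsFree) :
    formsOp φ ω - ∑ i ∈ Finset.range N,
      (PowerSeries.X : JetSeries) ^ i •
        (algebraMap ℚ JetSeries (PowerSeries.coeff i φ) • (formsDer ^ i) ω) ∈
      Ideal.span {(PowerSeries.X : JetSeries) ^ N} • (⊤ : Submodule JetSeries formsFree) := by
  set η := formsOp φ ω - ∑ i ∈ Finset.range N,
      (PowerSeries.X : JetSeries) ^ i •
        (algebraMap ℚ JetSeries (PowerSeries.coeff i φ) • (formsDer ^ i) ω) with hη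
  have h0 : ∀ x, ∀ n < N, PowerSeries.coeff n (η.1 x) = 0 := by
    intro x n hn
    have h1 : η.1 x = (formsOp φ ω).1 x - ∑ i ∈ Finset.range N,
      (PowerSeries.X : JetSeries) ^ i *
        (PowerSeries.coeff i φ • ((formsDer ^ i) ω).1 x) := by
      rw [hη]
      simp [Algebra.smul_def]
    rw [h1, map_sub, map_sum, sub_eq_zero]
    simp only [PowerSeries.coeff_X_pow_mul']
    rw [← Finset.sum_filter]
    have h : {i ∈ Finset.range N | i ≤ n} = Finset.range (n + 1) := by
      ext i
      simp
      omega
    rw [h]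
    simp [formsOp]
  let θ : formsFree := ⟨fun x => PowerSeries.mk fun n => PowerSeries.coeff (n + N) (η.1 x), by
    intro n
    simpa using η.2 (n + N)⟩
  have h2 : η = (PowerSeries.X : JetSeries) ^ N • θ := by
    ext x n : 3
    change _ = PowerSeries.coeff n ((PowerSeries.X : JetSeries) ^ N * θ.1 x)
    rw [PowerSeries.coeff_X_pow_mul']
    split_ifs with hn
    · simp [θ, Nat.sub_add_cancel hn]
    · exact h0 x n (by omega)
  rw [h2]
  exact Submodule.smul_mem_smul (Ideal.mem_span_singleton_self _) trivial

theorem formsOp_mem_formsRel (φ : PowerSeries ℚ) {ω : formsFree} (hω : ω ∈ formsRel) :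
    formsOp φ ω ∈ formsRel := by
  have hi : ∀ i : ℕ, (formsDer ^ i) ω ∈ formsRel := by
    intro i
    induction i with
    | zero => simpa using hω
    | succ i ih =>
      rw [pow_succ', Module.End.mul_apply]
      exact formsDer_mem_formsRel ih
  rw [formsRel, Submodule.mem_iInf]
  intro N
  have h := formsOp_sub_mem φ N ω
  rw [← sub_add_cancel (formsOp φ ω) (∑ i ∈ Finset.range N, (PowerSeries.X : JetSeries) ^ i •
        (algebraMap ℚ JetSeries (PowerSeries.coeff i φ) • (formsDer ^ i) ω))]
  refine add_mem (Submodule.mem_sup_right h) ?_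
  refine Submodule.sum_mem _ fun i _ => Submodule.smul_mem _ _ (Submodule.smul_mem _ _ ?_)
  have := hi i
  rw [formsRel, Submodule.mem_iInf] at this
  exact this N

theorem seriesD_mem_formsRel {f : JetSeries} (hf : f ∈ relIdeal) : seriesD f ∈ formsRel := by
  rw [formsRel, Submodule.mem_iInf]
  exact fun N => Submodule.mem_sup_left (Submodule.mem_sup_right
    (Submodule.subset_span ⟨f, hf, rfl⟩))

theorem isTorsionBySet_forms : Module.IsTorsionBySet JetSeries (formsFree ⧸ formsRel) relIdeal := by
  rintro x ⟨f, hf⟩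
  induction x using Submodule.Quotient.induction_on with
  | H ω =>
    rw [← Submodule.Quotient.mk_smul, Submodule.Quotient.mk_eq_zero, formsRel, Submodule.mem_iInf]
    exact fun N => Submodule.mem_sup_left (Submodule.mem_sup_left
      (Submodule.smul_mem_smul hf trivial))

/-- `Forms` as a module over `Toda`. -/
instance : Module Toda Forms := isTorsionBySet_forms.module

/-- The map induced on a quotient by a map over the constants. -/
def quotMap {M M' : Type} [AddCommGroup M] [AddCommGroup M'] [Module JetSeries M]
    [Module JetSeries M'] [Module Const M] [Module Const M'] [IsScalarTower Const JetSeries M]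
    [IsScalarTower Const JetSeries M'] (N : Submodule JetSeries M) (N' : Submodule JetSeries M')
    (f : M →ₗ[Const] M') (h : ∀ x ∈ N, f x ∈ N') : (M ⧸ N) →ₗ[Const] (M' ⧸ N') :=
  (Submodule.Quotient.restrictScalarsEquiv Const N').toLinearMap ∘ₗ
    Submodule.mapQ (N.restrictScalars Const) (N'.restrictScalars Const) f h ∘ₗ
    (Submodule.Quotient.restrictScalarsEquiv Const N).symm.toLinearMap

/-- The derivation `∂` of `Toda`. -/
def der : Toda →ₗ[Const] Toda :=
  quotMap relIdeal relIdeal seriesDer fun _ => seriesDer_mem_relIdeal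

/-- The operator `φ(ε∂)` on `Toda`. -/
def op (φ : PowerSeries ℚ) : Toda →ₗ[Const] Toda :=
  quotMap relIdeal relIdeal (seriesOp φ) fun _ => seriesOp_mem_relIdeal φ

/-- The universal differential `d : Toda → Ω`, relative to the constants. -/
def dForm : Toda →ₗ[Const] Forms :=
  quotMap relIdeal formsRel seriesD fun _ => seriesD_mem_formsRel

/-- The action of `∂` on `Ω`. -/
def formDer : Forms →ₗ[Const] Forms :=
  quotMap formsRel formsRel formsDer fun _ => formsDer_mem_formsRel

/-- The operator `φ(ε∂)` on `Ω`. -/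
def formOp (φ : PowerSeries ℚ) : Forms →ₗ[Const] Forms :=
  quotMap formsRel formsRel (formsOp φ) fun _ => formsOp_mem_formsRel φ

theorem formDer_dForm (f : Toda) : formDer (dForm f) = dForm (der f) := by
  induction f using Submodule.Quotient.induction_on with
  | H f => exact congrArg (Submodule.Quotient.mk (p := formsRel)) (formsDer_seriesD f)

/-! ### Composition of the operators -/

theorem coeff_seriesDer_pow (i n : ℕ) (f : JetSeries) :
    PowerSeries.coeff n ((seriesDer ^ i) f) = (jetDer^[i]) (PowerSeries.coeff n f) := by
  induction i generalizing f with
  | zero => simp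
  | succ i ih => rw [pow_succ, Module.End.mul_apply, ih, coeff_seriesDer, Function.iterate_succ_apply]

theorem iterate_jetDer_sum (i : ℕ) {ι : Type} (s : Finset ι) (c : ι → ℚ) (f : ι → JetPoly) :
    (jetDer^[i]) (∑ j ∈ s, c j • f j) = ∑ j ∈ s, c j • (jetDer^[i]) (f j) := by
  induction i generalizing f with
  | zero => simp
  | succ i ih =>
    have h : ∀ (c : ℚ) (f : JetPoly), jetDer (c • f) = c • jetDer f := fun c f => by
      rw [← algebraMap_smul Const c f, jetDer.map_smul, algebraMap_smul]
    rw [Function.iterate_succ_apply, map_sum]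
    simp only [h, ih, Function.iterate_succ_apply]

theorem coeff_seriesOp (φ : PowerSeries ℚ) (n : ℕ) (f : JetSeries) :
    PowerSeries.coeff n (seriesOp φ f) = ∑ p ∈ Finset.HasAntidiagonal.antidiagonal n,
      PowerSeries.coeff p.1 φ • (jetDer^[p.1]) (PowerSeries.coeff p.2 f) := by
  rw [Finset.Nat.sum_antidiagonal_eq_sum_range_succ_mk]
  simp [seriesOp, coeff_seriesDer_pow]

theorem seriesOp_mul (φ ψ : PowerSeries ℚ) (f : JetSeries) :
    seriesOp (φ * ψ) f = seriesOp φ (seriesOp ψ f) := by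
  ext1 n
  simp only [coeff_seriesOp, PowerSeries.coeff_mul, Finset.sum_smul, iterate_jetDer_sum,
    Finset.smul_sum]
  rw [Finset.sum_sigma', Finset.sum_sigma']
  refine Finset.sum_nbij' (fun x => ⟨(x.2.1, x.2.2 + x.1.2), (x.2.2, x.1.2)⟩)
    (fun x => ⟨(x.1.1 + x.2.1, x.2.2), (x.1.1, x.2.1)⟩) ?_ ?_ ?_ ?_ ?_
  · rintro ⟨⟨a, b⟩, c, d⟩ hx
    simp only [Finset.mem_sigma, Finset.HasAntidiagonal.mem_antidiagonal] at hx ⊢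
    exact ⟨by omega, by trivial⟩
  · rintro ⟨⟨a, b⟩, c, d⟩ hx
    simp only [Finset.mem_sigma, Finset.HasAntidiagonal.mem_antidiagonal] at hx ⊢
    exact ⟨by omega, by trivial⟩
  · rintro ⟨⟨a, b⟩, c, d⟩ hx
    simp only [Finset.mem_sigma, Finset.HasAntidiagonal.mem_antidiagonal] at hx
    simp only [hx.2]
  · rintro ⟨⟨a, b⟩, c, d⟩ hx
    simp only [Finset.mem_sigma, Finset.HasAntidiagonal.mem_antidiagonal] at hx
    simp only [hx.2]
  · rintro ⟨⟨a, b⟩, c, d⟩ hx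
    simp only [Finset.mem_sigma, Finset.HasAntidiagonal.mem_antidiagonal] at hx
    obtain ⟨h1, rfl⟩ := hx
    simp only [mul_smul, ← Function.iterate_add_apply]

theorem seriesOp_one (f : JetSeries) : seriesOp 1 f = f := by
  ext1 n
  rw [coeff_seriesOp, Finset.sum_eq_single (0, n)]
  · simp
  · rintro ⟨i, j⟩ hp hne
    have hi : i ≠ 0 := by
      rintro rfl
      simp at hp
      exact hne (by simp [hp])
    simp [PowerSeries.coeff_one, hi]
  · simp

theorem op_mul (φ ψ : PowerSeries ℚ) (f : Toda) : op (φ * ψ) f = op φ (op ψ f) := by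
  induction f using Submodule.Quotient.induction_on with
  | H f => exact congrArg (Submodule.Quotient.mk (p := relIdeal)) (seriesOp_mul φ ψ f)

theorem op_one (f : Toda) : op 1 f = f := by
  induction f using Submodule.Quotient.induction_on with
  | H f => exact congrArg (Submodule.Quotient.mk (p := relIdeal)) (seriesOp_one f)

theorem seriesOp_add (φ ψ : PowerSeries ℚ) (f : JetSeries) :
    seriesOp (φ + ψ) f = seriesOp φ f + seriesOp ψ f := by
  ext1 n
  simp [coeff_seriesOp, add_smul, Finset.sum_add_distrib]

theorem op_add (φ ψ : PowerSeries ℚ) (f : Toda) : op (φ + ψ) f = op φ f + op ψ f := by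
  induction f using Submodule.Quotient.induction_on with
  | H f => exact congrArg (Submodule.Quotient.mk (p := relIdeal)) (seriesOp_add φ ψ f)

theorem seriesOp_apply_one (φ : PowerSeries ℚ) (hφ : PowerSeries.coeff 0 φ = 1) :
    seriesOp φ 1 = 1 := by
  have h : ∀ i : ℕ, (jetDer^[i + 1]) (1 : JetPoly) = 0 := by
    intro i
    induction i with
    | zero => simp
    | succ i ih => rw [Function.iterate_succ_apply', ih, map_zero]
  have h' : ∀ i : ℕ, (jetDer^[i]) (0 : JetPoly) = 0 := fun i => by
    induction i with
    | zero => simp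
    | succ i ih => rw [Function.iterate_succ_apply', ih, map_zero]
  ext1 n
  rw [coeff_seriesOp, Finset.sum_eq_single (0, n)]
  · simp [hφ]
  · rintro ⟨i, j⟩ hp hne
    rw [PowerSeries.coeff_one]
    cases i with
    | zero =>
      simp at hp
      exact absurd (by simp [hp]) hne
    | succ i =>
      dsimp only
      split_ifs
      · rw [h, smul_zero]
      · rw [h', smul_zero]
  · simp

theorem op_apply_one (φ : PowerSeries ℚ) (hφ : PowerSeries.coeff 0 φ = 1) : op φ 1 = 1 :=
  congrArg (Submodule.Quotient.mk (p := relIdeal)) (seriesOp_apply_one φ hφ)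

theorem expSymbol_mul (s t : ℚ) : expSymbol s * expSymbol t = expSymbol (s + t) := by
  have h : ∀ s, expSymbol s = PowerSeries.rescale s (PowerSeries.exp ℚ) := fun s => by
    ext n
    simp [expSymbol, PowerSeries.coeff_exp, div_eq_mul_inv]
  rw [h, h, h, PowerSeries.exp_mul_exp_eq_exp_add]

theorem bracketSymbol_succ (n : ℕ) :
    bracketSymbol (n + 1) = expSymbol (1 / 2) * bracketSymbol n + expSymbol (-(n : ℚ) / 2) := by
  rw [bracketSymbol, Finset.sum_Icc_succ_top (by omega), bracketSymbol, Finset.mul_sum]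
  congr 1
  · refine Finset.sum_congr rfl fun j _ => ?_
    rw [expSymbol_mul]
    congr 1
    push_cast
    ring
  · congr 1
    push_cast
    ring

theorem constantCoeff_bracketSymbol (n : ℕ) :
    PowerSeries.constantCoeff (bracketSymbol n) = n := by
  simp [bracketSymbol, expSymbol]

theorem op_bracketSymbol_inv (n : ℕ) (f : Toda) :
    op (bracketSymbol (n + 1)) (op (bracketSymbol (n + 1))⁻¹ f) = f := by
  rw [← op_mul, PowerSeries.mul_inv_cancel _ (by
    rw [constantCoeff_bracketSymbol]
    positivity), op_one]

/-! ### Difference operators -/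

/-- Series `∑ m_k Λ^k` with coefficients in `M` and `m_k = 0` for `k ≫ 0`. For `M = Toda` this is
the algebra `Φ₋` of difference operators; for `M = Forms` it is the module of difference operators
whose coefficients are differential forms. -/
structure DiffOp (M : Type) [Zero M] where
  coeff : ℤ → M
  bdd : ∃ N : ℤ, ∀ k > N, coeff k = 0

/-- The shift `E^s` on `Toda`. -/
def shift (s : ℚ) : Toda →ₗ[Const] Toda := op (expSymbol s)

/-- The shift `E^s` on `Forms`. -/
def formShift (s : ℚ) : Forms →ₗ[Const] Forms := formOp (expSymbol s)

/-- The product `∑ a_i Λ^i * ∑ b_j Λ^j = ∑_k (∑_{i+j=k} (E^{-j/2} a_i) (E^{i/2} b_j)) Λ^k`, where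
`σ s` is the shift `E^s` on the coefficients `b_j`. -/
def DiffOp.product {M : Type} [AddCommGroup M] [Module Const M] [Module Toda M]
    (σ : ℚ → M →ₗ[Const] M) (A : DiffOp Toda) (B : DiffOp M) : DiffOp M where
  coeff k := ∑ᶠ i : ℤ, shift (-((k - i : ℤ) : ℚ) / 2) (A.coeff i) •
    σ ((i : ℚ) / 2) (B.coeff (k - i))
  bdd := by
    obtain ⟨N, hN⟩ := A.bdd
    obtain ⟨N', hN'⟩ := B.bdd
    refine ⟨N + N', fun k hk => finsum_eq_zero_of_forall_eq_zero fun i => ?_⟩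
    by_cases hi : N < i
    · rw [hN i hi, map_zero, zero_smul]
    · rw [hN' (k - i) (by omega), map_zero, smul_zero]

/-- The product of difference operators. -/
instance : Mul (DiffOp Toda) := ⟨DiffOp.product shift⟩

/-- The product of a difference operator with a form-valued difference operator. -/
instance : HMul (DiffOp Toda) (DiffOp Forms) (DiffOp Forms) := ⟨DiffOp.product formShift⟩

/-- The difference operator `1`. -/
instance : One (DiffOp Toda) where
  one := ⟨fun k => if k = 0 then 1 else 0, 0, fun _ hk => if_neg (ne_of_gt hk)⟩

/-- The powers `A^n`. -/
def DiffOp.power (A : DiffOp Toda) : ℕ → DiffOp Toda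
  | 0 => 1
  | n + 1 => A * A.power n

instance : Pow (DiffOp Toda) ℕ := ⟨DiffOp.power⟩

/-- The coefficientwise differential `d(∑ p_k Λ^k) = ∑ dp_k Λ^k`. -/
def DiffOp.d (A : DiffOp Toda) : DiffOp Forms where
  coeff k := dForm (A.coeff k)
  bdd := by
    obtain ⟨N, hN⟩ := A.bdd
    exact ⟨N, fun k hk => by rw [hN k hk, map_zero]⟩

/-! ### The Lax operator -/

/-- The element `q` of `Toda`. -/
def q : Toda := Ideal.Quotient.mk relIdeal (gen Gen.q)

/-- The element `v` of `Toda`. -/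
def v : Toda := Ideal.Quotient.mk relIdeal (gen Gen.v)

/-- The operator `P = ∂ / ∇` on `Toda`. -/
def opP : Toda →ₗ[Const] Toda := op pSymbol

/-- The operator `Λ + ∑_{k ≥ 1} a_k Λ^{1-k}`; the value `a 0` is not used. -/
def ofLower (a : ℕ → Toda) : DiffOp Toda where
  coeff j := if j = 1 then 1 else if j ≤ 0 then a (1 - j).toNat else 0
  bdd := ⟨1, fun j hj => by rw [if_neg (by omega), if_neg (by omega)]⟩

/-- The element `p_{-1}(k) - q p_1(k) - τ P p_0(k)`, where `A^k = ∑_j p_j(k) Λ^j`. -/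
def motion (A : DiffOp Toda) (k : ℕ) : Toda :=
  (A ^ k).coeff (-1) - q * (A ^ k).coeff 1 - tau • opP ((A ^ k).coeff 0)

/-- The sequence `laxSeq n` agrees with the coefficients `a_k` of the Lax operator for
`1 ≤ k ≤ n + 1` and vanishes beyond. -/
def laxSeq : ℕ → ℕ → Toda
  | 0 => Pi.single 1 v
  | n + 1 => Function.update (laxSeq n) (n + 2) (op (bracketSymbol (n + 1))⁻¹
      (algebraMap Const Toda (z (n + 1)) - motion (ofLower (laxSeq n)) (n + 1)))

/-- The coefficients `a_k`, for `k ≥ 1`, of the Lax operator; see `laxCoeff_one` and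
`motion_lax`. -/
def laxCoeff (k : ℕ) : Toda := laxSeq k k

/-- The Lax operator `L = Λ + ∑_{k ≥ 1} a_k Λ^{1-k}` of the equivariant Toda lattice, with `a_1 = v`
and the other coefficients determined by the equations
`p_{-1}(k) - q p_1(k) - τ P p_0(k) = z_k` for `k ≥ 1`. -/
def lax : DiffOp Toda := ofLower laxCoeff

theorem laxCoeff_one : laxCoeff 1 = v := by
  simp [laxCoeff, laxSeq]

theorem laxSeq_of_lt {n k : ℕ} (hk : n + 1 < k) : laxSeq n k = 0 := by
  induction n with
  | zero =>
    have h : k ≠ 1 := by omega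
    simp [laxSeq, h]
  | succ n ih =>
    rw [laxSeq, Function.update_of_ne (by omega), ih (by omega)]

theorem laxSeq_eq {n k : ℕ} (hk : k ≤ n + 1) : laxSeq n k = laxCoeff k := by
  induction n with
  | zero =>
    interval_cases k <;> simp [laxCoeff, laxSeq]
  | succ n ih =>
    by_cases h : k = n + 2
    · subst h
      simp [laxCoeff, laxSeq]
    · rw [laxSeq, Function.update_of_ne h, ih (by omega)]

theorem shift_one (s : ℚ) : shift s 1 = 1 :=
  op_apply_one _ (by simp [expSymbol])

theorem coeff_pow_succ (A : DiffOp Toda) (n : ℕ) (m : ℤ) :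
    (A ^ (n + 1)).coeff m = ∑ᶠ i : ℤ, shift (-((m - i : ℤ) : ℚ) / 2) (A.coeff i) *
      shift ((i : ℚ) / 2) ((A ^ n).coeff (m - i)) := rfl

theorem coeff_pow_zero (A : DiffOp Toda) (m : ℤ) :
    (A ^ 0).coeff m = if m = 0 then 1 else 0 := rfl

theorem ofLower_one (a : ℕ → Toda) : (ofLower a).coeff 1 = 1 := rfl

theorem ofLower_of_gt (a : ℕ → Toda) {j : ℤ} (hj : 1 < j) : (ofLower a).coeff j = 0 := by
  have h1 : j ≠ 1 := by omega
  have h2 : ¬ j ≤ 0 := by omega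
  simp [ofLower, h1, h2]

theorem ofLower_of_le (a : ℕ → Toda) {j : ℤ} (hj : j ≤ 0) :
    (ofLower a).coeff j = a (1 - j).toNat := by
  have h1 : j ≠ 1 := by omega
  simp [ofLower, h1, hj]

theorem coeff_ofLower_pow_of_gt (a : ℕ → Toda) (n : ℕ) {m : ℤ} (hm : n < m) :
    ((ofLower a) ^ n).coeff m = 0 := by
  induction n generalizing m with
  | zero => rw [coeff_pow_zero, if_neg (by simpa using ne_of_gt hm)]
  | succ n ih =>
    rw [coeff_pow_succ]
    refine finsum_eq_zero_of_forall_eq_zero fun i => ?_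
    by_cases hi : 1 < i
    · rw [ofLower_of_gt a hi, map_zero, zero_mul]
    · rw [ih (by push_cast at hm; omega), map_zero, mul_zero]

theorem coeff_ofLower_pow_self (a : ℕ → Toda) (n : ℕ) : ((ofLower a) ^ n).coeff n = 1 := by
  induction n with
  | zero => simp [coeff_pow_zero]
  | succ n ih =>
    rw [coeff_pow_succ, finsum_eq_single _ 1]
    · rw [ofLower_one, shift_one, one_mul, (by push_cast; ring : ((n + 1 : ℕ) : ℤ) - 1 = n), ih,
        shift_one]
    · intro i hi
      by_cases h : 1 < i
      · rw [ofLower_of_gt a h, map_zero, zero_mul]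
      · rw [coeff_ofLower_pow_of_gt a n (by push_cast; omega), map_zero, mul_zero]

theorem coeff_ofLower_pow_eq {a b : ℕ → Toda} {k : ℕ} (hab : ∀ j, 1 ≤ j → j ≤ k → a j = b j)
    (n : ℕ) {m : ℤ} (hm : (n : ℤ) - k ≤ m) :
    ((ofLower a) ^ n).coeff m = ((ofLower b) ^ n).coeff m := by
  induction n generalizing m with
  | zero => rfl
  | succ n ih =>
    rw [coeff_pow_succ, coeff_pow_succ]
    refine finsum_congr fun i => ?_
    push_cast at hm
    by_cases h : 1 < i
    · rw [ofLower_of_gt a h, ofLower_of_gt b h, map_zero, zero_mul, zero_mul]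
    by_cases h' : (n : ℤ) < m - i
    · rw [coeff_ofLower_pow_of_gt a n h', coeff_ofLower_pow_of_gt b n h', map_zero, mul_zero,
        mul_zero]
    rw [ih (by omega)]
    congr 2
    by_cases hi : i = 1
    · rw [hi, ofLower_one, ofLower_one]
    · rw [ofLower_of_le a (by omega), ofLower_of_le b (by omega)]
      exact hab _ (by omega) (by omega)

theorem coeff_ofLower_pow_sub {a b : ℕ → Toda} {k : ℕ} (hk : 1 ≤ k)
    (hab : ∀ j, 1 ≤ j → j ≤ k → a j = b j) (n : ℕ) :
    ((ofLower a) ^ n).coeff (n - 1 - k) = ((ofLower b) ^ n).coeff (n - 1 - k) +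
      op (bracketSymbol n) (a (k + 1) - b (k + 1)) := by
  induction n with
  | zero =>
    have h : bracketSymbol 0 = 0 := by simp [bracketSymbol]
    have h0 : ∀ f : Toda, op 0 f = 0 := fun f => by
      have := op_add 0 0 f
      simpa using this
    rw [coeff_pow_zero, coeff_pow_zero, h, h0, add_zero]
  | succ n ih =>
    have hm : ((n + 1 : ℕ) : ℤ) - 1 - k = n - k := by push_cast; ring
    rw [hm, coeff_pow_succ, coeff_pow_succ]
    have hsub : ∀ c : ℕ → Toda, (Function.support fun i : ℤ =>
        shift (-((n - k - i : ℤ) : ℚ) / 2) ((ofLower c).coeff i) *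
          shift ((i : ℚ) / 2) (((ofLower c) ^ n).coeff (n - k - i))) ⊆
        (Finset.Icc (-k : ℤ) 1 : Finset ℤ) := by
      intro c i hi
      by_contra h
      rw [Finset.coe_Icc, Set.mem_Icc, not_and_or] at h
      refine hi ?_
      dsimp only
      rcases h with h | h
      · rw [coeff_ofLower_pow_of_gt c n (by omega), map_zero, mul_zero]
      · rw [ofLower_of_gt c (by omega), map_zero, zero_mul]
    rw [finsum_eq_sum_of_support_subset _ (hsub a), finsum_eq_sum_of_support_subset _ (hsub b),
      ← sub_eq_iff_eq_add', ← Finset.sum_sub_distrib,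
      ← Finset.sum_subset (s₁ := {(-k : ℤ), 1}), Finset.sum_pair (by omega)]
    · rw [ofLower_one, ofLower_one, ofLower_of_le a (by omega), ofLower_of_le b (by omega),
        (by ring : (n - k - -k : ℤ) = n), coeff_ofLower_pow_self, coeff_ofLower_pow_self,
        (by omega : (1 - -(k : ℤ)).toNat = k + 1), (by ring : (n - k - 1 : ℤ) = n - 1 - k), ih,
        bracketSymbol_succ, op_add, op_mul]
      simp only [shift_one, mul_one, one_mul, map_add, map_sub]
      simp only [shift]
      push_cast
      ring
    · intro i hi
      simp only [Finset.mem_insert, Finset.mem_singleton] at hi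
      rw [Finset.mem_Icc]
      omega
    · intro i hi hi'
      rw [Finset.mem_Icc] at hi
      simp only [Finset.mem_insert, Finset.mem_singleton, not_or] at hi'
      rw [coeff_ofLower_pow_eq hab n (by omega), ofLower_of_le a (by omega),
        ofLower_of_le b (by omega), hab _ (by omega) (by omega), sub_self]

/-- The defining equations of the Lax operator. -/
theorem motion_lax (k : ℕ) (hk : 1 ≤ k) : motion lax k = algebraMap Const Toda (z k) := by
  obtain ⟨n, rfl⟩ : ∃ n, k = n + 1 := ⟨k - 1, by omega⟩
  have hab : ∀ j, 1 ≤ j → j ≤ n + 1 → laxCoeff j = laxSeq n j := fun j _ hj => (laxSeq_eq hj).symm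
  have h1 := coeff_ofLower_pow_eq hab (n + 1) (m := 1) (by omega)
  have h0 := coeff_ofLower_pow_eq hab (n + 1) (m := 0) (by omega)
  have h2 := coeff_ofLower_pow_sub hk hab (n + 1)
  rw [(by push_cast; ring : ((n + 1 : ℕ) : ℤ) - 1 - (n + 1 : ℕ) = -1),
    laxSeq_of_lt (by omega : n + 1 < n + 1 + 1), sub_zero] at h2
  have h3 : op (bracketSymbol (n + 1)) (laxCoeff (n + 1 + 1)) =
      algebraMap Const Toda (z (n + 1)) - motion (ofLower (laxSeq n)) (n + 1) := by
    rw [laxCoeff, laxSeq, Function.update_of_ne (by omega), laxSeq, Function.update_self,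
      op_bracketSymbol_inv]
  rw [motion, lax, h1, h0, h2, h3, motion]
  ring

/-- The operator `K = Λ + v + q Λ⁻¹`. -/
def opK : DiffOp Toda where
  coeff j := if j = 1 then 1 else if j = 0 then v else if j = -1 then q else 0
  bdd := ⟨1, fun j hj => by rw [if_neg (by omega), if_neg (by omega), if_neg (by omega)]⟩

/-! ### Functionals, residues and Hamiltonians -/

/-- The space `Toda / ∂ Toda` of functionals. -/
abbrev Functional : Type := Toda ⧸ LinearMap.range der

/-- The quotient `Ω / ∂ Ω`. -/
abbrev FormFunctional : Type := Forms ⧸ LinearMap.range formDer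

/-- The differential `d : Toda / ∂ Toda → Ω / ∂ Ω`. -/
def dFunctional : Functional →ₗ[Const] FormFunctional :=
  Submodule.mapQ _ _ dForm (by
    rintro _ ⟨f, rfl⟩
    exact ⟨dForm f, formDer_dForm f⟩)

/-- The trace `Res (∑ f_k Λ^k) = ∫ f_0 dx`. -/
def residue (A : DiffOp Toda) : Functional := Submodule.Quotient.mk (A.coeff 0)

/-- The trace `Res (∑ ω_k Λ^k) = ∫ ω_0 dx` of a form-valued difference operator. -/
def formResidue (A : DiffOp Forms) : FormFunctional := Submodule.Quotient.mk (A.coeff 0)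

/-- The functional `h_n = Res (L^{n+1}) / (n+1)`. -/
def h (n : ℕ) : Functional :=
  algebraMap ℚ Const (1 / ((n : ℚ) + 1)) • residue (lax ^ (n + 1))

/-- The functional `H_n = h_n - τ h_{n-1} + ∑_{k=1}^{n-1} z_k h_{n-k-1}`, with `h_{-1} = 0`. -/
def hamiltonian : ℕ → Functional
  | 0 => h 0
  | n + 1 => h (n + 1) - tau • h n + ∑ k ∈ Finset.Icc 1 n, z k • h (n - k)

theorem residue_d (A : DiffOp Toda) : dFunctional (residue A) = formResidue A.d := rfl

end EquivariantToda

end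

/-! The theorem rests on the identity L - K = τ (log L - log Λ) + ∑_{k≥1} (z_k/k) L^{-k}
(`laxSubK_eq`). Granting it, Res(L^n dK) equals Res(L^n dL) - τ Res(L^n d log L) - ∑ (z_k/k) Res(L^n
d(L^{-k})). Modulo ∂ the residue is a trace, so the three kinds of terms are dh_n, τ dh_{n-1} and
-z_k dh_{n-k-1} (`formTrace_laxPow_eq`, `formTrace_laxLog_eq`, `formTrace_laxTail`), which add up to
dH_n.

To make sense of L^{-k} and log L, the coefficient c_j(m) of Λ^{m-j} in L^m is constructed for every
integer m, in the free algebra and for an arbitrary sequence of coefficients with leading term 1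
(`laxPow`). At each power of ε it is polynomial in m, and log L is the derivative of L^m at m = 0. A
polynomial identity known at all integers may be differentiated, so statements about log L follow
from statements about powers. Exactness modulo ∂ survives this as well, since the derivative of a
polynomial function with values in a subspace lies in that subspace (`HasPolyDeriv.mem`).

The statements about powers come from additivity in m. The Λ⁰ coefficient of a commutator [A, B] is
ε∂ of an explicit bilinear expression `cyclic` in A and B. This expression is a cyclic cocycle
(`cyclic_star_add`), so its value on (L^m, L^{k-m}) is additive in m. It vanishes at m = k, hence
for all m if k ≠ 0; for k = 0 it equals m. In the same way the trace of L^{k-m} d(L^m) is additive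
in m by the Leibniz rule, hence proportional to m.

Finally, applying ∇/∂ to the equation p_{-1}(k) - q p_1(k) - τ P p_0(k) = z_k, and rewriting
p_{-1}(k) by the vanishing of `cyclic` on (L, L^k), gives a triangular linear system for the
coefficients of L - K (`laxSubK_equation`). The right-hand side of the identity solves the same
system (`laxTail_equation`), and the solution is unique because the diagonal symbols are invertible.
-/

noncomputable section

namespace EquivariantToda

open Finset.HasAntidiagonal (antidiagonal)

/-! ### Polynomial functions on the integers and their derivative at zero -/

section PolyDeriv

variable {V W U : Type} [AddCommGroup V] [Module ℚ V] [AddCommGroup W] [Module ℚ W]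
  [AddCommGroup U] [Module ℚ U]

/-- The pairs `(f, g)` of a polynomial function `f : ℤ → V` and its derivative `g` at zero. -/
def polyDeriv (V : Type) [AddCommGroup V] [Module ℚ V] : Submodule ℚ ((ℤ → V) × V) :=
  Submodule.span ℚ (Set.range fun p : ℕ × V =>
    ((fun m : ℤ => (m : ℚ) ^ p.1 • p.2, if p.1 = 1 then p.2 else 0) : (ℤ → V) × V))

/-- `f : ℤ → V` is polynomial with derivative `g` at zero. -/
def HasPolyDeriv (f : ℤ → V) (g : V) : Prop := (f, g) ∈ polyDeriv V

theorem HasPolyDeriv.monomial (k : ℕ) (v : V) :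
    HasPolyDeriv (fun m : ℤ => (m : ℚ) ^ k • v) (if k = 1 then v else 0) :=
  Submodule.subset_span ⟨(k, v), rfl⟩

theorem HasPolyDeriv.const (v : V) : HasPolyDeriv (fun _ => v) 0 := by
  simpa using HasPolyDeriv.monomial 0 v

theorem HasPolyDeriv.linear (v : V) : HasPolyDeriv (fun m : ℤ => (m : ℚ) • v) v := by
  simpa using HasPolyDeriv.monomial 1 v

theorem HasPolyDeriv.add {f f' : ℤ → V} {g g' : V} (h : HasPolyDeriv f g)
    (h' : HasPolyDeriv f' g') : HasPolyDeriv (fun m => f m + f' m) (g + g') :=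
  Submodule.add_mem _ h h'

theorem HasPolyDeriv.sub {f f' : ℤ → V} {g g' : V} (h : HasPolyDeriv f g)
    (h' : HasPolyDeriv f' g') : HasPolyDeriv (fun m => f m - f' m) (g - g') :=
  Submodule.sub_mem _ h h'

theorem HasPolyDeriv.smul {f : ℤ → V} {g : V} (c : ℚ) (h : HasPolyDeriv f g) :
    HasPolyDeriv (fun m => c • f m) (c • g) :=
  Submodule.smul_mem _ c h

theorem HasPolyDeriv.sum {ι : Type} (s : Finset ι) {f : ι → ℤ → V} {g : ι → V}
    (h : ∀ i ∈ s, HasPolyDeriv (f i) (g i)) :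
    HasPolyDeriv (fun m => ∑ i ∈ s, f i m) (∑ i ∈ s, g i) := by
  classical
  induction s using Finset.induction_on with
  | empty => simpa using HasPolyDeriv.const (0 : V)
  | insert a s ha ih =>
    simp only [Finset.sum_insert ha]
    exact (h a (by simp)).add (ih fun i hi => h i (by simp [hi]))

/-- Induction principle for polynomial functions. -/
theorem HasPolyDeriv.induction {p : (ℤ → V) → V → Prop}
    (mono : ∀ k v, p (fun m : ℤ => (m : ℚ) ^ k • v) (if k = 1 then v else 0))
    (zero : p (fun _ => 0) 0)
    (add : ∀ f g f' g', p f g → p f' g' → p (fun m => f m + f' m) (g + g'))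
    (smul : ∀ (c : ℚ) f g, p f g → p (fun m => c • f m) (c • g))
    {f : ℤ → V} {g : V} (h : HasPolyDeriv f g) : p f g := by
  refine Submodule.span_induction (p := fun x _ => p x.1 x.2) ?_ zero ?_ ?_ h
  · rintro _ ⟨⟨k, v⟩, rfl⟩
    exact mono k v
  · rintro ⟨f, g⟩ ⟨f', g'⟩ _ _ h h'
    exact add _ _ _ _ h h'
  · rintro c ⟨f, g⟩ _ h
    exact smul c _ _ h

theorem HasPolyDeriv.map (T : V →ₗ[ℚ] W) {f : ℤ → V} {g : V} (h : HasPolyDeriv f g) :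
    HasPolyDeriv (fun m => T (f m)) (T g) := by
  refine HasPolyDeriv.induction (p := fun f g => HasPolyDeriv (fun m => T (f m)) (T g))
    ?_ ?_ ?_ ?_ h
  · intro k v
    have := HasPolyDeriv.monomial k (T v)
    simp only [map_smul]
    convert this using 1
    split_ifs <;> simp
  · simpa using HasPolyDeriv.const (0 : W)
  · intro f g f' g' h h'
    simpa only [map_add] using h.add h'
  · intro c f g h
    simpa only [map_smul] using h.smul c

/-- The product rule at zero. On monomials the exponents add, and a sum of two exponents is 1 only
as 1 + 0 or 0 + 1, which gives the two terms. -/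
theorem HasPolyDeriv.bilin (B : V →ₗ[ℚ] W →ₗ[ℚ] U) {f : ℤ → V} {g : V} {f' : ℤ → W} {g' : W}
    (h : HasPolyDeriv f g) (h' : HasPolyDeriv f' g') :
    HasPolyDeriv (fun m => B (f m) (f' m)) (B g (f' 0) + B (f 0) g') := by
  refine HasPolyDeriv.induction
    (p := fun f g => HasPolyDeriv (fun m => B (f m) (f' m)) (B g (f' 0) + B (f 0) g'))
    ?_ ?_ ?_ ?_ h
  · intro k v
    refine HasPolyDeriv.induction (p := fun f' g' => HasPolyDeriv
      (fun m : ℤ => B ((m : ℚ) ^ k • v) (f' m))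
      (B (if k = 1 then v else 0) (f' 0) + B (((0 : ℤ) : ℚ) ^ k • v) g')) ?_ ?_ ?_ ?_ h'
    · intro l w
      have := HasPolyDeriv.monomial (k + l) (B v w)
      simp only [map_smul, LinearMap.smul_apply, smul_smul]
      convert this using 1
      · funext m
        rw [pow_add, mul_comm]
      · rcases k with _ | _ | k <;> rcases l with _ | _ | l <;> simp
        omega
    · simpa using HasPolyDeriv.const (0 : U)
    · intro f g f' g' h h'
      simp only [map_add]
      convert h.add h' using 1
      abel
    · intro c f g h
      simp only [map_smul] at h ⊢
      convert h.smul c using 1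
      simp only [smul_add]
  · simpa using HasPolyDeriv.const (0 : U)
  · intro f g f' g' h h'
    simp only [map_add, LinearMap.add_apply]
    convert h.add h' using 1
    abel
  · intro c f g h
    simp only [map_smul, LinearMap.smul_apply]
    convert h.smul c using 1
    simp only [smul_add]

theorem HasPolyDeriv.eval (q : Polynomial ℚ) (v : V) :
    HasPolyDeriv (fun m : ℤ => q.eval (m : ℚ) • v) (q.coeff 1 • v) := by
  have := HasPolyDeriv.sum q.support (f := fun i (m : ℤ) => q.coeff i • ((m : ℚ) ^ i • v))
    (fun i _ => (HasPolyDeriv.monomial i v).smul (q.coeff i))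
  convert this using 1
  · funext m
    rw [Polynomial.eval_eq_sum, Polynomial.sum, Finset.sum_smul]
    simp only [smul_smul]
  · simp only [smul_ite, smul_zero]
    rw [Finset.sum_ite_eq']
    split_ifs with h
    · rfl
    · rw [Polynomial.notMem_support_iff.1 h, zero_smul]

theorem HasPolyDeriv.exists_polynomial {f : ℤ → ℚ} {g : ℚ} (h : HasPolyDeriv f g) :
    ∃ q : Polynomial ℚ, (∀ m : ℤ, f m = q.eval (m : ℚ)) ∧ g = q.coeff 1 := by
  refine HasPolyDeriv.induction
    (p := fun f g => ∃ q : Polynomial ℚ, (∀ m : ℤ, f m = q.eval (m : ℚ)) ∧ g = q.coeff 1)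
    ?_ ?_ ?_ ?_ h
  · intro k v
    refine ⟨Polynomial.C v * Polynomial.X ^ k, fun m => ?_, ?_⟩
    · rw [Polynomial.eval_C_mul, Polynomial.eval_pow, Polynomial.eval_X]
      exact mul_comm _ _
    · rw [Polynomial.coeff_C_mul, Polynomial.coeff_X_pow, mul_ite, mul_one, mul_zero]
      exact if_congr eq_comm rfl rfl
  · exact ⟨0, by simp, by simp⟩
  · rintro f g f' g' ⟨q, h, rfl⟩ ⟨q', h', rfl⟩
    exact ⟨q + q', fun m => by simp [h, h'], by simp⟩
  · rintro c f g ⟨q, h, rfl⟩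
    exact ⟨Polynomial.C c * q, fun m => by simp [h], by simp⟩

/-- Linear functionals reduce the claim to a rational polynomial with infinitely many roots. This
makes the derivative well defined and allows polynomial identities over ℤ to be differentiated. -/
theorem HasPolyDeriv.eq_zero {f : ℤ → V} {g : V} (h : HasPolyDeriv f g) (hf : ∀ m, f m = 0) :
    g = 0 := by
  rw [← Module.forall_dual_apply_eq_zero_iff ℚ]
  intro φ
  obtain ⟨q, hq, hg⟩ := (h.map φ).exists_polynomial
  have hq0 : q = 0 := by
    refine Polynomial.eq_zero_of_infinite_isRoot q ?_
    refine (Set.infinite_range_of_injective (Int.cast_injective (α := ℚ))).mono ?_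
    rintro _ ⟨m, rfl⟩
    simp [Polynomial.IsRoot, ← hq, hf]
  rw [hg, hq0, Polynomial.coeff_zero]

/-- A polynomial function with values in a subspace has its derivative in the subspace. -/
theorem HasPolyDeriv.mem {f : ℤ → V} {g : V} (h : HasPolyDeriv f g) (S : Submodule ℚ V)
    (hf : ∀ m, f m ∈ S) : g ∈ S := by
  rw [← Submodule.Quotient.mk_eq_zero]
  exact (h.map S.mkQ).eq_zero fun m => (Submodule.Quotient.mk_eq_zero S).2 (hf m)

theorem HasPolyDeriv.exists_antidifference {f : ℤ → V} {g : V} (h : HasPolyDeriv f g) :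
    ∃ F G, HasPolyDeriv F G ∧ ∀ m : ℤ, F (m + 1) - F m = f m := by
  refine HasPolyDeriv.induction
    (p := fun f _ => ∃ F G, HasPolyDeriv F G ∧ ∀ m : ℤ, F (m + 1) - F m = f m) ?_ ?_ ?_ ?_ h
  · intro k v
    -- Bernoulli polynomials satisfy B_{k+1}(x + 1) - B_{k+1}(x) = (k + 1) x^k.
    refine ⟨_, _, HasPolyDeriv.eval (Polynomial.C ((k : ℚ) + 1)⁻¹ * Polynomial.bernoulli (k + 1)) v,
      fun m => ?_⟩
    have h1 := Polynomial.bernoulli_eval_one_add (k + 1) (m : ℚ)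
    have h2 : ((k : ℚ) + 1) ≠ 0 := by positivity
    rw [← sub_smul]
    congr 1
    push_cast at h1 ⊢
    rw [add_comm (m : ℚ), Polynomial.eval_mul, Polynomial.eval_mul, h1]
    simp
    field_simp
    ring
  · exact ⟨_, _, HasPolyDeriv.const 0, by simp⟩
  · rintro f g f' g' ⟨F, G, h, hF⟩ ⟨F', G', h', hF'⟩
    exact ⟨_, _, h.add h', fun m => by dsimp only; rw [← hF, ← hF']; abel⟩
  · rintro c f g ⟨F, G, h, hF⟩
    exact ⟨_, _, h.smul c, fun m => by dsimp only; rw [← hF, smul_sub]⟩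

/-- Two functions on ℤ with the same first difference differ by a constant, so F is a polynomial
antidifference of f plus a constant. -/
theorem HasPolyDeriv.of_difference {f F : ℤ → V} {g : V} (h : HasPolyDeriv f g)
    (hF : ∀ m : ℤ, F (m + 1) = F m + f m) : ∃ G, HasPolyDeriv F G := by
  obtain ⟨F', G', h', hF'⟩ := h.exists_antidifference
  have hc : ∀ m : ℤ, F m = F' m + (F 0 - F' 0) := by
    intro m
    induction m using Int.induction_on with
    | zero => abel
    | succ n ih => rw [hF, ih, ← hF']; abel
    | pred n ih =>
      have h1 := hF (-n - 1)
      have h2 := hF' (-n - 1)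
      rw [sub_add_cancel] at h1 h2
      rw [h1, ← h2] at ih
      have : F (-n - 1) = (F (-n - 1) + (F' (-n) - F' (-n - 1))) - F' (-n) + F' (-n - 1) := by abel
      rw [this, ih]
      abel
  refine ⟨G' + 0, ?_⟩
  convert h'.add (HasPolyDeriv.const (F 0 - F' 0)) using 1
  exact funext hc

theorem HasPolyDeriv.reflect {f : ℤ → V} {g : V} (h : HasPolyDeriv f g) (k : ℤ) :
    ∃ G, HasPolyDeriv (fun m => f (k - m)) G := by
  refine HasPolyDeriv.induction (p := fun f _ => ∃ G, HasPolyDeriv (fun m => f (k - m)) G)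
    ?_ ?_ ?_ ?_ h
  · intro n v
    have := HasPolyDeriv.eval ((Polynomial.C (k : ℚ) - Polynomial.X) ^ n) v
    exact ⟨_, by simpa using this⟩
  · exact ⟨_, HasPolyDeriv.const 0⟩
  · rintro f g f' g' ⟨G, h⟩ ⟨G', h'⟩
    exact ⟨_, h.add h'⟩
  · rintro c f g ⟨G, h⟩
    exact ⟨_, h.smul c⟩

end PolyDeriv

/-! ### Indefinite sums over the integers -/

/-- The sum of `h` from `0` to `m - 1`, extended to all integers `m`. -/
def intSum {M : Type} [AddCommGroup M] (h : ℤ → M) (m : ℤ) : M :=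
  ∑ i ∈ Finset.range m.toNat, h i - ∑ i ∈ Finset.range (-m).toNat, h (-1 - i)

theorem intSum_zero {M : Type} [AddCommGroup M] (h : ℤ → M) : intSum h 0 = 0 := by
  simp [intSum]

theorem intSum_add_one {M : Type} [AddCommGroup M] (h : ℤ → M) (m : ℤ) :
    intSum h (m + 1) = intSum h m + h m := by
  rcases le_or_gt 0 m with hm | hm
  · obtain ⟨n, rfl⟩ := Int.eq_ofNat_of_zero_le hm
    rw [intSum, intSum, (by omega : (-((n : ℤ) + 1)).toNat = 0),
      (by omega : ((n : ℤ) + 1).toNat = n + 1), (by omega : (-(n : ℤ)).toNat = 0),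
      Int.toNat_natCast, Finset.sum_range_succ]
    simp
  · obtain ⟨n, rfl⟩ : ∃ n : ℕ, m = -1 - n := ⟨(-1 - m).toNat, by omega⟩
    rw [intSum, intSum, (by omega : (-1 - (n : ℤ) + 1).toNat = 0),
      (by omega : (-(-1 - (n : ℤ) + 1)).toNat = n), (by omega : (-1 - (n : ℤ)).toNat = 0),
      (by omega : (-(-1 - (n : ℤ))).toNat = n + 1), Finset.sum_range_succ]
    abel

/-! ### Reindexing convolutions -/

/-- Both sides sum over 2 × 2 arrays with total n, and transposing the array matches them. -/
theorem sum_antidiagonal_quadruple {U : Type} [AddCommMonoid U] (G : ℕ → ℕ → ℕ → ℕ → U) (n : ℕ) :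
    ∑ p ∈ antidiagonal n, ∑ q ∈ antidiagonal p.1, ∑ r ∈ antidiagonal p.2, G q.1 q.2 r.1 r.2 =
    ∑ p ∈ antidiagonal n, ∑ q ∈ antidiagonal p.1, ∑ r ∈ antidiagonal p.2,
      G q.1 r.1 q.2 r.2 := by
  simp only [Finset.sum_sigma']
  refine Finset.sum_nbij'
    (fun x => ⟨(x.2.1.1 + x.2.2.1, x.2.1.2 + x.2.2.2), (x.2.1.1, x.2.2.1), (x.2.1.2, x.2.2.2)⟩)
    (fun x => ⟨(x.2.1.1 + x.2.2.1, x.2.1.2 + x.2.2.2), (x.2.1.1, x.2.2.1), (x.2.1.2, x.2.2.2)⟩)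
    ?_ ?_ ?_ ?_ ?_ <;> rintro ⟨⟨a, b⟩, ⟨c, d⟩, e, f⟩ hx <;>
    simp only [Finset.mem_sigma, Finset.HasAntidiagonal.mem_antidiagonal] at hx ⊢
  · exact ⟨by omega, trivial, trivial⟩
  · exact ⟨by omega, trivial, trivial⟩
  · obtain ⟨h1, rfl, rfl⟩ := hx
    trivial
  · obtain ⟨h1, rfl, rfl⟩ := hx
    trivial

theorem sum_antidiagonal_assoc {U : Type} [AddCommMonoid U] (G : ℕ → ℕ → ℕ → U) (n : ℕ) :
    ∑ p ∈ antidiagonal n, ∑ q ∈ antidiagonal p.2, G p.1 q.1 q.2 =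
    ∑ p ∈ antidiagonal n, ∑ q ∈ antidiagonal p.1, G q.1 q.2 p.2 := by
  simp only [Finset.sum_sigma']
  refine Finset.sum_nbij' (fun x => ⟨(x.1.1 + x.2.1, x.2.2), (x.1.1, x.2.1)⟩)
    (fun x => ⟨(x.2.1, x.2.2 + x.1.2), (x.2.2, x.1.2)⟩) ?_ ?_ ?_ ?_ ?_ <;>
    rintro ⟨⟨a, b⟩, c, d⟩ hx <;>
    simp only [Finset.mem_sigma, Finset.HasAntidiagonal.mem_antidiagonal] at hx ⊢
  · exact ⟨by omega, trivial⟩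
  · exact ⟨by omega, trivial⟩
  · obtain ⟨h1, rfl⟩ := hx
    trivial
  · obtain ⟨h1, rfl⟩ := hx
    trivial

theorem sum_antidiagonal_rotate {U : Type} [AddCommMonoid U] (G : ℕ → ℕ → ℕ → U) (n : ℕ) :
    ∑ p ∈ antidiagonal n, ∑ q ∈ antidiagonal p.1, G q.1 q.2 p.2 =
    ∑ p ∈ antidiagonal n, ∑ q ∈ antidiagonal p.1, G p.2 q.1 q.2 := by
  rw [← sum_antidiagonal_assoc]
  rw [← Finset.Nat.sum_antidiagonal_swap]
  rfl

/-! ### Shifts are multiplicative -/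

section Leibniz

variable {V W U : Type} [AddCommGroup V] [Module ℚ V] [AddCommGroup W] [Module ℚ W]
  [AddCommGroup U] [Module ℚ U] (B : V →ₗ[ℚ] W →ₗ[ℚ] U) {D₁ : Module.End ℚ V}
  {D₂ : Module.End ℚ W} {D₃ : Module.End ℚ U}

theorem pow_leibniz (hD : ∀ x y, D₃ (B x y) = B (D₁ x) y + B x (D₂ y)) (n : ℕ) (x : V) (y : W) :
    (D₃ ^ n) (B x y) =
      ∑ p ∈ antidiagonal n, n.choose p.1 • B ((D₁ ^ p.1) x) ((D₂ ^ p.2) y) := by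
  induction n with
  | zero => simp
  | succ n ih =>
    rw [Finset.sum_antidiagonal_choose_succ_nsmul
      (fun i j => B ((D₁ ^ i) x) ((D₂ ^ j) y)), pow_succ', Module.End.mul_apply, ih, map_sum,
      ← Finset.sum_add_distrib]
    refine Finset.sum_congr rfl fun p hp => ?_
    rw [Finset.HasAntidiagonal.mem_antidiagonal] at hp
    have hc : n.choose p.2 = n.choose p.1 := by
      rw [← hp]
      exact (Nat.choose_symm_add).symm
    rw [hc, map_nsmul, hD, pow_succ', pow_succ', Module.End.mul_apply, Module.End.mul_apply,
      nsmul_add, add_comm]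

theorem exp_leibniz (hD : ∀ x y, D₃ (B x y) = B (D₁ x) y + B x (D₂ y)) (s : ℚ) (n : ℕ)
    (x : V) (y : W) :
    (s ^ n / n.factorial) • (D₃ ^ n) (B x y) =
      ∑ p ∈ antidiagonal n, B ((s ^ p.1 / p.1.factorial) • (D₁ ^ p.1) x)
        ((s ^ p.2 / p.2.factorial) • (D₂ ^ p.2) y) := by
  rw [pow_leibniz B hD, Finset.smul_sum]
  refine Finset.sum_congr rfl fun p hp => ?_
  rw [Finset.HasAntidiagonal.mem_antidiagonal] at hp
  rw [map_smul, map_smul, LinearMap.smul_apply, smul_smul, ← Nat.cast_smul_eq_nsmul ℚ, smul_smul]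
  congr 1
  subst hp
  have h1 : (p.1.factorial : ℚ) ≠ 0 := by positivity
  have h2 : (p.2.factorial : ℚ) ≠ 0 := by positivity
  have h3 : ((p.1 + p.2).factorial : ℚ) ≠ 0 := by positivity
  have h4 : ((p.1 + p.2).choose p.1 : ℚ) * p.1.factorial * p.2.factorial =
    (p.1 + p.2).factorial := by
    rw [Nat.choose_symm_add]
    exact_mod_cast Nat.add_choose_mul_factorial_mul_factorial p.1 p.2
  rw [pow_add]
  field_simp
  rw [← h4]
  ring

/-- The exponential of a derivation is multiplicative, read off at ε^n. Stated for a bilinear map so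
that it serves both products of series and the action of series on forms. -/
theorem exp_convolution (hD : ∀ x y, D₃ (B x y) = B (D₁ x) y + B x (D₂ y)) (s : ℚ) (n : ℕ)
    (x : ℕ → V) (y : ℕ → W) :
    ∑ p ∈ antidiagonal n, (s ^ p.1 / p.1.factorial) •
        (D₃ ^ p.1) (∑ q ∈ antidiagonal p.2, B (x q.1) (y q.2)) =
      ∑ p ∈ antidiagonal n,
        B (∑ q ∈ antidiagonal p.1, (s ^ q.1 / q.1.factorial) • (D₁ ^ q.1) (x q.2))
          (∑ q ∈ antidiagonal p.2, (s ^ q.1 / q.1.factorial) • (D₂ ^ q.1) (y q.2)) := by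
  simp only [map_sum, LinearMap.sum_apply, Finset.smul_sum, exp_leibniz B hD]
  have h := sum_antidiagonal_quadruple (fun a b c d => B ((s ^ a / a.factorial) • (D₁ ^ a) (x c))
        ((s ^ b / b.factorial) • (D₂ ^ b) (y d))) n
  have hl : ∀ p : ℕ × ℕ, ∑ q ∈ antidiagonal p.2, ∑ r ∈ antidiagonal p.1,
      B ((s ^ r.1 / r.1.factorial) • (D₁ ^ r.1) (x q.1))
        ((s ^ r.2 / r.2.factorial) • (D₂ ^ r.2) (y q.2)) =
      ∑ r ∈ antidiagonal p.1, ∑ q ∈ antidiagonal p.2,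
      B ((s ^ r.1 / r.1.factorial) • (D₁ ^ r.1) (x q.1))
        ((s ^ r.2 / r.2.factorial) • (D₂ ^ r.2) (y q.2)) := fun p => Finset.sum_comm
  simp only [hl]
  rw [h]
  refine Finset.sum_congr rfl fun p _ => ?_
  rw [Finset.sum_comm]

end Leibniz

/-- The derivation `∂` of differential polynomials, as a linear map over `ℚ`. -/
def jetEnd : Module.End ℚ JetPoly := (jetDer : JetPoly →ₗ[Const] JetPoly).restrictScalars ℚ

theorem jetEnd_pow (i : ℕ) (f : JetPoly) : (jetEnd ^ i) f = jetDer^[i] f := by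
  rw [Module.End.pow_apply]
  rfl

theorem coeff_seriesOp_eq (φ : PowerSeries ℚ) (n : ℕ) (f : JetSeries) :
    PowerSeries.coeff n (seriesOp φ f) = ∑ p ∈ antidiagonal n,
      PowerSeries.coeff p.1 φ • (jetEnd ^ p.1) (PowerSeries.coeff p.2 f) := by
  simp only [coeff_seriesOp, jetEnd_pow]

/-- The shift `E^s` on `JetSeries`. -/
def jetShift (s : ℚ) : JetSeries →ₗ[Const] JetSeries := seriesOp (expSymbol s)

theorem coeff_jetShift (s : ℚ) (n : ℕ) (f : JetSeries) :
    PowerSeries.coeff n (jetShift s f) = ∑ p ∈ antidiagonal n,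
      (s ^ p.1 / p.1.factorial) • (jetEnd ^ p.1) (PowerSeries.coeff p.2 f) := by
  simp only [jetShift, coeff_seriesOp_eq, expSymbol, PowerSeries.coeff_mk]

theorem jetShift_mul (s : ℚ) (f g : JetSeries) :
    jetShift s (f * g) = jetShift s f * jetShift s g := by
  ext1 n
  rw [PowerSeries.coeff_mul, coeff_jetShift]
  simp only [coeff_jetShift, PowerSeries.coeff_mul]
  refine exp_convolution (LinearMap.mul ℚ JetPoly) (D₁ := jetEnd) (D₂ := jetEnd) ?_ s n
    (fun i => PowerSeries.coeff i f) (fun i => PowerSeries.coeff i g)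
  intro x y
  change jetDer (x * y) = jetDer x * y + x * jetDer y
  rw [Derivation.leibniz, smul_eq_mul, smul_eq_mul]
  ring

theorem expSymbol_zero : expSymbol 0 = 1 := by
  ext n
  cases n <;> simp [expSymbol, PowerSeries.coeff_one]

theorem jetShift_jetShift (s t : ℚ) (f : JetSeries) :
    jetShift s (jetShift t f) = jetShift (s + t) f := by
  rw [jetShift, jetShift, jetShift, ← seriesOp_mul, expSymbol_mul]

theorem jetShift_zero (f : JetSeries) : jetShift 0 f = f := by
  rw [jetShift, expSymbol_zero, seriesOp_one]

theorem jetShift_one (s : ℚ) : jetShift s 1 = 1 :=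
  seriesOp_apply_one _ (by simp [expSymbol])

/-! ### Differential forms, one power of `ε` at a time -/

/-- The coefficient of `εⁿ` in a form. -/
def formsCoeff (n : ℕ) : formsFree →ₗ[ℚ] (Jet → JetPoly) where
  toFun ω x := PowerSeries.coeff n (ω.1 x)
  map_add' ω η := by
    funext x
    simp
  map_smul' c ω := by
    funext x
    exact PowerSeries.coeff_smul n (ω.1 x) c

theorem forms_ext {ω η : formsFree} (h : ∀ n, formsCoeff n ω = formsCoeff n η) : ω = η := by
  ext x n : 3
  exact congrFun (h n) x

/-- The action of `∂` on families of coefficients of forms. -/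
def famDer : Module.End ℚ (Jet → JetPoly) where
  toFun θ x := jetEnd (θ x) + (match x with
    | (_, 0) => 0
    | (g, k + 1) => θ (g, k))
  map_add' θ η := by
    funext ⟨g, k⟩
    cases k <;> simp
    abel
  map_smul' c θ := by
    funext ⟨g, k⟩
    cases k <;> simp

theorem formsCoeff_formsDer (n : ℕ) (ω : formsFree) :
    formsCoeff n (formsDer ω) = famDer (formsCoeff n ω) := by
  funext ⟨g, k⟩
  cases k with
  | zero =>
    change PowerSeries.coeff n (seriesDer (ω.1 (g, 0))) =
      jetDer (PowerSeries.coeff n (ω.1 (g, 0))) + 0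
    rw [coeff_seriesDer, add_zero]
  | succ k =>
    change PowerSeries.coeff n (seriesDer (ω.1 (g, k + 1)) + ω.1 (g, k)) =
      jetDer (PowerSeries.coeff n (ω.1 (g, k + 1))) + PowerSeries.coeff n (ω.1 (g, k))
    rw [map_add, coeff_seriesDer]

theorem formsCoeff_formsDer_pow (n i : ℕ) (ω : formsFree) :
    formsCoeff n ((formsDer ^ i) ω) = (famDer ^ i) (formsCoeff n ω) := by
  induction i with
  | zero => simp
  | succ i ih => rw [pow_succ', pow_succ', Module.End.mul_apply, Module.End.mul_apply,
      formsCoeff_formsDer, ih]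

theorem formsCoeff_formsOp (φ : PowerSeries ℚ) (n : ℕ) (ω : formsFree) :
    formsCoeff n (formsOp φ ω) = ∑ p ∈ antidiagonal n,
      PowerSeries.coeff p.1 φ • (famDer ^ p.1) (formsCoeff p.2 ω) := by
  rw [Finset.Nat.sum_antidiagonal_eq_sum_range_succ_mk]
  simp only [← formsCoeff_formsDer_pow]
  funext x
  rw [Finset.sum_apply]
  simp [formsCoeff, formsOp]

theorem formsCoeff_smul (n : ℕ) (f : JetSeries) (ω : formsFree) :
    formsCoeff n (f • ω) = ∑ p ∈ antidiagonal n, PowerSeries.coeff p.1 f • formsCoeff p.2 ω := by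
  funext x
  rw [Finset.sum_apply]
  exact PowerSeries.coeff_mul n f (ω.1 x)

/-- The shift `E^s` on forms. -/
def formsShift (s : ℚ) : formsFree →ₗ[Const] formsFree := formsOp (expSymbol s)

theorem formsCoeff_formsShift (s : ℚ) (n : ℕ) (ω : formsFree) :
    formsCoeff n (formsShift s ω) = ∑ p ∈ antidiagonal n,
      (s ^ p.1 / p.1.factorial) • (famDer ^ p.1) (formsCoeff p.2 ω) := by
  simp only [formsShift, formsCoeff_formsOp, expSymbol, PowerSeries.coeff_mk]

/-- Multiplication of families of coefficients by differential polynomials. -/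
def famSmul : JetPoly →ₗ[ℚ] (Jet → JetPoly) →ₗ[ℚ] (Jet → JetPoly) :=
  LinearMap.mk₂ ℚ (fun f θ => f • θ) (fun _ _ _ => add_smul _ _ _)
    (fun c f θ => smul_assoc c f θ) (fun _ _ _ => smul_add _ _ _)
    (fun c f θ => smul_comm f c θ)

theorem formsShift_smul (s : ℚ) (f : JetSeries) (ω : formsFree) :
    formsShift s (f • ω) = jetShift s f • formsShift s ω := by
  refine forms_ext fun n => ?_
  rw [formsCoeff_smul, formsCoeff_formsShift]
  simp only [coeff_jetShift, formsCoeff_formsShift, formsCoeff_smul]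
  refine exp_convolution famSmul (D₁ := jetEnd) (D₂ := famDer) ?_ s n
    (fun i => PowerSeries.coeff i f) (fun i => formsCoeff i ω)
  intro x y
  funext ⟨g, k⟩
  have h : jetDer (x * y (g, k)) = jetDer x * y (g, k) + x * jetDer (y (g, k)) := by
    rw [Derivation.leibniz, smul_eq_mul, smul_eq_mul]
    ring
  cases k with
  | zero =>
    change jetDer (x * y (g, 0)) + 0 = jetDer x * y (g, 0) + x * (jetDer (y (g, 0)) + 0)
    rw [h]
    ring
  | succ k =>
    change jetDer (x * y (g, k + 1)) + x * y (g, k) =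
      jetDer x * y (g, k + 1) + x * (jetDer (y (g, k + 1)) + y (g, k))
    rw [h]
    ring

theorem formsOp_seriesD (φ : PowerSeries ℚ) (f : JetSeries) :
    formsOp φ (seriesD f) = seriesD (seriesOp φ f) := by
  refine forms_ext fun n => ?_
  have h : ∀ n (f : JetSeries) , formsCoeff n (seriesD f) =
      fun x => jetPderiv x (PowerSeries.coeff n f) := fun n f => by
    funext x
    exact coeff_seriesD n f x
  have hi : ∀ i, (formsDer ^ i) (seriesD f) = seriesD ((seriesDer ^ i) f) := fun i => by
    induction i with
    | zero => simp
    | succ i ih => rw [pow_succ', pow_succ', Module.End.mul_apply, Module.End.mul_apply, ih,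
        formsDer_seriesD]
  rw [formsCoeff_formsOp, h]
  funext x
  rw [coeff_seriesOp, Finset.sum_apply, map_sum]
  refine Finset.sum_congr rfl fun p _ => ?_
  rw [← formsCoeff_formsDer_pow, hi, h, ← coeff_seriesDer_pow]
  exact (((jetPderiv x : JetPoly →ₗ[Const] JetPoly).restrictScalars ℚ).map_smul _ _).symm

theorem seriesD_jetShift (s : ℚ) (f : JetSeries) :
    seriesD (jetShift s f) = formsShift s (seriesD f) :=
  (formsOp_seriesD _ _).symm

/-! ### Exact forms -/

/-- The image under `∂` of the families with finitely many nonzero entries. -/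
def famExact : Submodule ℚ (Jet → JetPoly) :=
  Submodule.map famDer
    { carrier := {θ | {x | θ x ≠ 0}.Finite}
      zero_mem' := by simp
      add_mem' := fun {a b} ha hb => by
        refine (Set.Finite.union ha hb).subset fun x hx => ?_
        by_contra h
        simp only [Set.mem_union, Set.mem_ofPred_eq, not_or, not_not] at h
        exact hx (by simp [h.1, h.2])
      smul_mem' := fun c a ha => by
        refine Set.Finite.subset ha fun x hx h => hx ?_
        simp [h] }

theorem famDer_formsCoeff_mem (n : ℕ) (ω : formsFree) : famDer (formsCoeff n ω) ∈ famExact :=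
  Submodule.mem_map_of_mem (ω.2 n)

/-- ∂ does not mix powers of ε, so antiderivatives may be chosen separately at each power and
assembled. The finite support built into `famExact` is what makes the assembled family an element of
`formsFree`. -/
theorem mem_range_formsDer {ω : formsFree} :
    ω ∈ LinearMap.range formsDer ↔ ∀ n, formsCoeff n ω ∈ famExact := by
  constructor
  · rintro ⟨η, rfl⟩ n
    rw [formsCoeff_formsDer]
    exact famDer_formsCoeff_mem n η
  · intro h
    choose θ hθ hθ' using h
    refine ⟨⟨fun x => PowerSeries.mk fun n => θ n x, fun n => ?_⟩, forms_ext fun n => ?_⟩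
    · simpa using hθ n
    · rw [formsCoeff_formsDer, ← hθ']
      congr 1
      funext x
      simp [formsCoeff]

/-- After the term of order zero is removed, every remaining term of φ(ε∂)ω has a factor ∂. -/
theorem formsOp_sub_mem_range (φ : PowerSeries ℚ) (hφ : PowerSeries.coeff 0 φ = 1)
    (ω : formsFree) : formsOp φ ω - ω ∈ LinearMap.range formsDer := by
  rw [mem_range_formsDer]
  intro n
  rw [map_sub, formsCoeff_formsOp, Finset.Nat.sum_antidiagonal_eq_sum_range_succ_mk,
    Finset.sum_range_succ']
  simp only [hφ, pow_zero, one_smul, Nat.sub_zero, Module.End.one_apply, add_sub_cancel_right]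
  refine Submodule.sum_mem _ fun i _ => Submodule.smul_mem _ _ ?_
  rw [pow_succ', Module.End.mul_apply, ← formsCoeff_formsDer_pow]
  exact famDer_formsCoeff_mem _ _

theorem formsShift_sub_mem_range (s : ℚ) (ω : formsFree) :
    formsShift s ω - ω ∈ LinearMap.range formsDer :=
  formsOp_sub_mem_range _ (by simp [expSymbol]) ω

/-! ### Polynomial families of series and forms -/

/-- Every coefficient of the power series `f m` is polynomial in `m`, and `g` is the derivative of
`f` at zero. -/
def SeriesHasPolyDeriv {A : Type} [CommRing A] [Algebra ℚ A] (f : ℤ → PowerSeries A)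
    (g : PowerSeries A) : Prop :=
  ∀ n, HasPolyDeriv (fun m => PowerSeries.coeff n (f m)) (PowerSeries.coeff n g)

/-- Every coefficient of the form `f m` is polynomial in `m`, and `g` is the derivative of `f` at
zero. -/
def FormsHasPolyDeriv (f : ℤ → formsFree) (g : formsFree) : Prop :=
  ∀ n, HasPolyDeriv (fun m => formsCoeff n (f m)) (formsCoeff n g)

section Series

variable {A : Type} [CommRing A] [Algebra ℚ A] {f f' : ℤ → PowerSeries A} {g g' : PowerSeries A}

theorem SeriesHasPolyDeriv.const (x : PowerSeries A) : SeriesHasPolyDeriv (fun _ => x) 0 :=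
  fun n => by simpa using HasPolyDeriv.const (PowerSeries.coeff n x)

theorem SeriesHasPolyDeriv.sub (h : SeriesHasPolyDeriv f g) (h' : SeriesHasPolyDeriv f' g') :
    SeriesHasPolyDeriv (fun m => f m - f' m) (g - g') :=
  fun n => by simpa only [map_sub] using (h n).sub (h' n)

theorem SeriesHasPolyDeriv.sum {ι : Type} (s : Finset ι) {f : ι → ℤ → PowerSeries A}
    {g : ι → PowerSeries A} (h : ∀ i ∈ s, SeriesHasPolyDeriv (f i) (g i)) :
    SeriesHasPolyDeriv (fun m => ∑ i ∈ s, f i m) (∑ i ∈ s, g i) :=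
  fun n => by
    simp only [map_sum]
    exact HasPolyDeriv.sum s fun i hi => h i hi n

theorem SeriesHasPolyDeriv.mul (h : SeriesHasPolyDeriv f g) (h' : SeriesHasPolyDeriv f' g') :
    SeriesHasPolyDeriv (fun m => f m * f' m) (g * f' 0 + f 0 * g') := by
  intro n
  simp only [map_add, PowerSeries.coeff_mul, ← Finset.sum_add_distrib]
  exact HasPolyDeriv.sum _ fun p _ => (h p.1).bilin (LinearMap.mul ℚ A) (h' p.2)

theorem SeriesHasPolyDeriv.eq_zero (h : SeriesHasPolyDeriv f g) (hf : ∀ m, f m = 0) : g = 0 := by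
  ext1 n
  rw [map_zero]
  exact (h n).eq_zero fun _ => by rw [hf, map_zero]

theorem SeriesHasPolyDeriv.unique (h : SeriesHasPolyDeriv f g) (h' : SeriesHasPolyDeriv f g') :
    g = g' :=
  sub_eq_zero.1 ((h.sub h').eq_zero fun _ => sub_self _)

theorem SeriesHasPolyDeriv.reflect (h : SeriesHasPolyDeriv f g) (k : ℤ) :
    ∃ G, SeriesHasPolyDeriv (fun m => f (k - m)) G := by
  choose G hG using fun n => (h n).reflect k
  exact ⟨PowerSeries.mk G, fun n => by simpa using hG n⟩

theorem SeriesHasPolyDeriv.intSum (h : SeriesHasPolyDeriv f g) :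
    ∃ G, SeriesHasPolyDeriv (intSum f) G := by
  choose G hG using fun n => (h n).of_difference
    (F := fun m => PowerSeries.coeff n (EquivariantToda.intSum f m))
    (fun m => by rw [intSum_add_one, map_add])
  exact ⟨PowerSeries.mk G, fun n => by simpa using hG n⟩

end Series

theorem SeriesHasPolyDeriv.seriesOp {φ : ℤ → PowerSeries ℚ} {ψ : PowerSeries ℚ}
    {f : ℤ → JetSeries} {g : JetSeries} (hφ : SeriesHasPolyDeriv φ ψ)
    (h : SeriesHasPolyDeriv f g) :
    SeriesHasPolyDeriv (fun m => seriesOp (φ m) (f m))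
      (EquivariantToda.seriesOp ψ (f 0) + EquivariantToda.seriesOp (φ 0) g) := by
  intro n
  simp only [map_add, coeff_seriesOp_eq, ← Finset.sum_add_distrib]
  exact HasPolyDeriv.sum _ fun p _ =>
    (hφ p.1).bilin ((LinearMap.lsmul ℚ JetPoly).compl₂ (jetEnd ^ p.1)) (h p.2)

theorem FormsHasPolyDeriv.sum {ι : Type} (s : Finset ι) {f : ι → ℤ → formsFree}
    {g : ι → formsFree} (h : ∀ i ∈ s, FormsHasPolyDeriv (f i) (g i)) :
    FormsHasPolyDeriv (fun m => ∑ i ∈ s, f i m) (∑ i ∈ s, g i) :=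
  fun n => by
    simp only [map_sum]
    exact HasPolyDeriv.sum s fun i hi => h i hi n

theorem FormsHasPolyDeriv.smul {f : ℤ → JetSeries} {g : JetSeries} {f' : ℤ → formsFree}
    {g' : formsFree} (h : SeriesHasPolyDeriv f g) (h' : FormsHasPolyDeriv f' g') :
    FormsHasPolyDeriv (fun m => f m • f' m) (g • f' 0 + f 0 • g') := by
  intro n
  simp only [map_add, formsCoeff_smul, ← Finset.sum_add_distrib]
  exact HasPolyDeriv.sum _ fun p _ => (h p.1).bilin famSmul (h' p.2)

/-- The family of partial derivatives of a differential polynomial. -/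
def jetGrad : JetPoly →ₗ[ℚ] (Jet → JetPoly) :=
  LinearMap.pi fun x => (jetPderiv x : JetPoly →ₗ[Const] JetPoly).restrictScalars ℚ

theorem formsCoeff_seriesD (n : ℕ) (f : JetSeries) :
    formsCoeff n (seriesD f) = jetGrad (PowerSeries.coeff n f) := by
  funext x
  exact coeff_seriesD n f x

theorem SeriesHasPolyDeriv.seriesD {f : ℤ → JetSeries} {g : JetSeries}
    (h : SeriesHasPolyDeriv f g) :
    FormsHasPolyDeriv (fun m => seriesD (f m)) (EquivariantToda.seriesD g) := by
  intro n
  simp only [formsCoeff_seriesD]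
  exact (h n).map jetGrad

theorem seriesD_one : seriesD 1 = 0 := by
  refine forms_ext fun n => ?_
  have h : jetGrad 1 = 0 := by
    funext x
    exact (jetPderiv x).map_one_eq_zero
  rw [formsCoeff_seriesD, PowerSeries.coeff_one, map_zero]
  split_ifs
  · exact h
  · exact map_zero _

/-! ### Symbols -/

/-- The symbol `(exp (s x / 2) - exp (-s x / 2)) / x`. -/
def sinhSymbol (s : ℚ) : PowerSeries ℚ :=
  PowerSeries.mk fun n => PowerSeries.coeff (n + 1) (expSymbol (s / 2) - expSymbol (-s / 2))

theorem sinhSymbol_one : sinhSymbol 1 = nablaSymbol := rfl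

theorem X_mul_sinhSymbol (s : ℚ) :
    PowerSeries.X * sinhSymbol s = expSymbol (s / 2) - expSymbol (-s / 2) := by
  ext n
  cases n with
  | zero => simp [expSymbol]
  | succ n => rw [PowerSeries.coeff_succ_X_mul, sinhSymbol, PowerSeries.coeff_mk]

theorem sinhSymbol_zero : sinhSymbol 0 = 0 := by
  simp [sinhSymbol]
  rfl

theorem sinhSymbol_neg (s : ℚ) : sinhSymbol (-s) = -sinhSymbol s := by
  ext n
  simp [sinhSymbol]

theorem coeff_zero_sinhSymbol (s : ℚ) : PowerSeries.coeff 0 (sinhSymbol s) = s := by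
  simp [sinhSymbol, expSymbol]
  ring

/-- After multiplication by x the six exponentials cancel in pairs. This is the scalar form of the
cocycle identity `cyclic_star_add`. -/
theorem sinhSymbol_cocycle {r s t : ℚ} (h : r + s + t = 0) :
    sinhSymbol t + expSymbol (s / 2) * sinhSymbol r + expSymbol (-r / 2) * sinhSymbol s = 0 := by
  refine mul_left_cancel₀ (PowerSeries.X_ne_zero (R := ℚ)) ?_
  rw [mul_zero, mul_add, mul_add, mul_left_comm, mul_left_comm PowerSeries.X (expSymbol (-r / 2)),
    X_mul_sinhSymbol, X_mul_sinhSymbol, X_mul_sinhSymbol, mul_sub, mul_sub]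
  simp only [expSymbol_mul]
  have ht : t = -r - s := by linarith
  subst ht
  rw [(by ring : (-r - s) / 2 = -r / 2 + -s / 2), (by ring : -(-r - s) / 2 = s / 2 + r / 2),
    (by ring : s / 2 + -r / 2 = -r / 2 + s / 2)]
  ring

theorem expSymbol_hasPolyDeriv (s t : ℚ) :
    ∃ ψ, SeriesHasPolyDeriv (fun m : ℤ => expSymbol (s * m + t)) ψ := by
  have key : ∀ n, ∃ g, HasPolyDeriv
      (fun m : ℤ => PowerSeries.coeff n (expSymbol (s * m + t))) g := by
    intro n
    have hf : (fun m : ℤ => PowerSeries.coeff n (expSymbol (s * m + t))) =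
        fun m : ℤ => ((Polynomial.C s * Polynomial.X + Polynomial.C t) ^ n).eval (m : ℚ) •
          (n.factorial : ℚ)⁻¹ := by
      funext m
      simp [expSymbol, div_eq_mul_inv]
    rw [hf]
    exact ⟨_, HasPolyDeriv.eval _ _⟩
  choose G hG using key
  exact ⟨PowerSeries.mk G, fun n => by simpa only [PowerSeries.coeff_mk] using hG n⟩

theorem sinhSymbol_hasPolyDeriv (t : ℚ) :
    ∃ ψ, SeriesHasPolyDeriv (fun m : ℤ => sinhSymbol (m + t)) ψ := by
  obtain ⟨ψ, h⟩ := expSymbol_hasPolyDeriv (1 / 2) (t / 2)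
  obtain ⟨ψ', h'⟩ := expSymbol_hasPolyDeriv (-1 / 2) (-t / 2)
  refine ⟨PowerSeries.mk fun n => PowerSeries.coeff (n + 1) (ψ - ψ'), fun n => ?_⟩
  have := h.sub h' (n + 1)
  simp only [sinhSymbol, PowerSeries.coeff_mk]
  convert this using 5 <;> ring

/-- The coefficient of x^n is a constant times m^{n+1}, so only n = 0 has a linear term, and its
constant is 1. -/
theorem sinhSymbol_hasPolyDeriv_zero :
    SeriesHasPolyDeriv (fun m : ℤ => sinhSymbol m) 1 := by
  intro n
  have hf : (fun m : ℤ => PowerSeries.coeff n (sinhSymbol m)) = fun m : ℤ => (m : ℚ) ^ (n + 1) •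
      (((1 / 2) ^ (n + 1) - (-1 / 2) ^ (n + 1)) / (n + 1).factorial : ℚ) := by
    funext m
    simp only [sinhSymbol, expSymbol, PowerSeries.coeff_mk, map_sub, smul_eq_mul]
    rw [(by ring : (m : ℚ) / 2 = m * (1 / 2)), (by ring : -(m : ℚ) / 2 = m * (-1 / 2)), mul_pow,
      mul_pow]
    ring
  have hg : PowerSeries.coeff n (1 : PowerSeries ℚ) = if n + 1 = 1 then
      (((1 / 2) ^ (n + 1) - (-1 / 2) ^ (n + 1)) / (n + 1).factorial : ℚ) else 0 := by
    rw [PowerSeries.coeff_one]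
    rcases n with _ | n <;> norm_num
  rw [hf, hg]
  exact HasPolyDeriv.monomial (n + 1) _

/-! ### Powers of a difference operator with leading term `Λ` -/

/-- The coefficients of the product `(∑ c_i Λ^{m-i}) (∑ d_j Λ^{n-j})`. -/
def star (m n : ℚ) (c d : ℕ → JetSeries) (k : ℕ) : JetSeries :=
  ∑ p ∈ antidiagonal k, jetShift (-(n - p.2) / 2) (c p.1) * jetShift ((m - p.1) / 2) (d p.2)

theorem star_assoc (m n p : ℚ) (c d e : ℕ → JetSeries) :
    star m (n + p) c (star n p d e) = star (m + n) p (star m n c d) e := by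
  funext k
  simp only [star, map_sum, jetShift_mul, jetShift_jetShift, Finset.mul_sum, Finset.sum_mul]
  have h := sum_antidiagonal_assoc (fun i j l =>
    jetShift (-(n + p - j - l) / 2) (c i) * (jetShift ((m - i) / 2 + -(p - l) / 2) (d j) *
      jetShift ((m - i) / 2 + (n - j) / 2) (e l))) k
  refine (Eq.trans ?_ h).trans ?_
  · refine Finset.sum_congr rfl fun x _ => Finset.sum_congr rfl fun y hy => ?_
    rw [Finset.HasAntidiagonal.mem_antidiagonal] at hy
    rw [← hy]
    push_cast
    ring_nf
  · refine Finset.sum_congr rfl fun x _ => Finset.sum_congr rfl fun y hy => ?_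
    rw [Finset.HasAntidiagonal.mem_antidiagonal] at hy
    rw [← hy, ← mul_assoc]
    push_cast
    ring_nf

theorem star_one_left (n : ℚ) (d : ℕ → JetSeries) :
    star 0 n (fun j => if j = 0 then 1 else 0) d = d := by
  funext k
  rw [star, Finset.sum_eq_single (0, k)]
  · simp [jetShift_one, jetShift_zero]
  · rintro ⟨i, j⟩ hp hne
    have hi : i ≠ 0 := by
      rintro rfl
      simp at hp
      exact hne (by simp [hp])
    simp [hi]
  · simp

theorem star_one_right (m : ℚ) (c : ℕ → JetSeries) :
    star m 0 c (fun j => if j = 0 then 1 else 0) = c := by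
  funext k
  rw [star, Finset.sum_eq_single (k, 0)]
  · simp [jetShift_one, jetShift_zero]
  · rintro ⟨i, j⟩ hp hne
    have hi : j ≠ 0 := by
      rintro rfl
      simp at hp
      exact hne (by simp [hp])
    simp [hi]
  · simp

/-- With leading coefficient 1, the k-th coefficient of the product is an invertible shift of the
k-th coefficient of the right factor, plus terms in its earlier coefficients. -/
theorem star_left_injective {m n : ℚ} {a c d : ℕ → JetSeries} (ha : a 0 = 1)
    (h : star m n a c = star m n a d) : c = d := by
  funext k
  induction k using Nat.strong_induction_on with
  | _ k ih =>
    have hk := congrFun h k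
    rw [star, star, ← sub_eq_zero, ← Finset.sum_sub_distrib, Finset.sum_eq_single (0, k)] at hk
    · simp only [ha, jetShift_one, one_mul, sub_eq_zero] at hk
      have := congrArg (jetShift (-((m - (0 : ℕ)) / 2))) hk
      simpa [jetShift_jetShift, jetShift_zero] using this
    · rintro ⟨i, j⟩ hp hne
      rw [Finset.HasAntidiagonal.mem_antidiagonal] at hp
      have hi : i ≠ 0 := by
        rintro rfl
        simp at hp
        exact hne (by simp [hp])
      dsimp only at hp ⊢
      rw [ih j (by omega), sub_self]
    · simp

/-- The coefficients `c_j` of `L^m = ∑ c_j Λ^{m-j}`, where `L = Λ + ∑_{i ≥ 1} a_i Λ^{1-i}`. -/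
def laxPow (a : ℕ → JetSeries) : ℕ → ℤ → JetSeries
  | 0 => fun _ => 1
  | j + 1 => fun m => jetShift (m / 2) (intSum (fun l => jetShift (-(l + 1) / 2)
      (∑ i : Fin (j + 1), jetShift (-(l - (j - i : ℕ)) / 2) (a (i + 1)) *
        jetShift ((1 - (i + 1 : ℕ)) / 2) (laxPow a (j - i) l))) m)
  termination_by j => j
  decreasing_by omega

variable {a : ℕ → JetSeries}

theorem laxPow_zero_right (a : ℕ → JetSeries) (j : ℕ) : laxPow a j 0 = if j = 0 then 1 else 0 := by
  cases j with
  | zero => simp [laxPow]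
  | succ j => simp [laxPow, intSum_zero]

theorem laxPow_zero_left (a : ℕ → JetSeries) (m : ℤ) : laxPow a 0 m = 1 := by
  rw [laxPow]

theorem laxPow_succ_left (a : ℕ → JetSeries) (j : ℕ) (m : ℤ) :
    laxPow a (j + 1) m = jetShift (m / 2) (intSum (fun l => jetShift (-(l + 1) / 2)
      (∑ i : Fin (j + 1), jetShift (-(l - (j - i : ℕ)) / 2) (a (i + 1)) *
        jetShift ((1 - (i + 1 : ℕ)) / 2) (laxPow a (j - i) l))) m) := by
  rw [laxPow]

/-- This recursion dictates the form of `laxPow`. The leading term of L contributes E^{1/2}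
c_{j+1}(m) to c_{j+1}(m + 1), so E^{-m/2} c_{j+1}(m) has a first difference involving only c_0, …,
c_j, and it is recovered by summation from its value 0 at m = 0. Summing in both directions yields
the negative powers too. -/
theorem laxPow_add_one (ha : a 0 = 1) (m : ℤ) (j : ℕ) :
    laxPow a j (m + 1) = star 1 m a (fun l => laxPow a l m) j := by
  rw [star, Finset.Nat.sum_antidiagonal_eq_sum_range_succ_mk]
  cases j with
  | zero => simp [laxPow, ha, jetShift_one]
  | succ j =>
    rw [Finset.sum_range_succ', laxPow_succ_left, intSum_add_one, map_add, jetShift_jetShift,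
      add_comm]
    congr 1
    · rw [Finset.sum_range, (by push_cast; ring : ((m + 1 : ℤ) : ℚ) / 2 + -((m : ℚ) + 1) / 2 = 0),
        jetShift_zero]
      refine Finset.sum_congr rfl fun i _ => ?_
      rw [(by omega : j + 1 - (i + 1) = j - i)]
    · rw [ha, jetShift_one, one_mul, Nat.sub_zero, laxPow_succ_left, jetShift_jetShift]
      push_cast
      ring_nf

theorem laxPow_add (ha : a 0 = 1) (m n : ℤ) :
    (fun j => laxPow a j (m + n)) = star m n (fun j => laxPow a j m) (fun j => laxPow a j n) := by
  have hs : ∀ m : ℤ, (fun j => laxPow a j (m + 1)) = star 1 m a (fun l => laxPow a l m) :=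
    fun m => funext (laxPow_add_one ha m)
  have key : ∀ m : ℤ, star ((m + 1 : ℤ) : ℚ) n (fun j => laxPow a j (m + 1))
      (fun j => laxPow a j n) =
      star 1 ((m + n : ℤ) : ℚ) a (star m n (fun j => laxPow a j m) (fun j => laxPow a j n)) := by
    intro m
    rw [hs, Int.cast_add, Int.cast_add, star_assoc, add_comm (m : ℚ) (1 : ℤ), Int.cast_one]
  induction m using Int.induction_on with
  | zero =>
    simp only [zero_add, laxPow_zero_right, Int.cast_zero]
    rw [star_one_left]
  | succ m ih =>
    rw [key, ← ih, ← hs]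
    simp only [add_right_comm]
  | pred m ih =>
    -- For the downward induction, multiply both sides by L on the left and cancel it.
    refine star_left_injective (m := 1) (n := ((-m - 1 + n : ℤ) : ℚ)) ha ?_
    rw [← key, ← hs]
    simp only [sub_add_cancel]
    rw [← ih]
    funext j
    congr 1
    ring

/-- Shifts by amounts affine in m, products and indefinite sums all preserve polynomial dependence
on m, so the recursion in j does too. -/
theorem exists_laxPow_hasPolyDeriv (a : ℕ → JetSeries) (j : ℕ) :
    ∃ g, SeriesHasPolyDeriv (laxPow a j) g := by
  induction j using Nat.strong_induction_on with
  | _ j ih =>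
    cases j with
    | zero => exact ⟨0, by
        have := SeriesHasPolyDeriv.const (1 : JetSeries)
        rwa [show (laxPow a 0) = fun _ => 1 from funext (laxPow_zero_left a)]⟩
    | succ j =>
      choose g hg using ih
      have hshift : ∀ (σ : ℤ → ℚ) (f : ℤ → JetSeries), (∃ s t, ∀ m : ℤ, σ m = s * m + t) →
          (∃ g, SeriesHasPolyDeriv f g) →
          ∃ g, SeriesHasPolyDeriv (fun m => jetShift (σ m) (f m)) g := by
        rintro σ f ⟨s, t, hσ⟩ ⟨g, hg⟩
        obtain ⟨ψ, hψ⟩ := expSymbol_hasPolyDeriv s t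
        simp only [← hσ] at hψ
        exact ⟨_, hψ.seriesOp hg⟩
      have h1 : ∀ i : Fin (j + 1), ∃ g, SeriesHasPolyDeriv (fun l : ℤ =>
          jetShift (-(l - (j - i : ℕ)) / 2) (a (i + 1)) *
            jetShift ((1 - (i + 1 : ℕ)) / 2) (laxPow a (j - i) l)) g := fun i => by
        obtain ⟨_, h1⟩ := hshift (fun l : ℤ => -(l - (j - i : ℕ)) / 2) _
          ⟨-1 / 2, (j - i : ℕ) / 2, fun m => by ring⟩ ⟨_, SeriesHasPolyDeriv.const (a (i + 1))⟩
        obtain ⟨_, h2⟩ := hshift (fun _ => (1 - (i + 1 : ℕ)) / 2) _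
          ⟨0, (1 - (i + 1 : ℕ)) / 2, fun m => by ring⟩ ⟨_, hg (j - i) (by omega)⟩
        exact ⟨_, h1.mul h2⟩
      choose g' hg' using h1
      obtain ⟨_, h2⟩ := hshift (fun l => -(l + 1) / 2) _ ⟨-1 / 2, -1 / 2, fun m => by ring⟩
        ⟨_, SeriesHasPolyDeriv.sum Finset.univ fun i _ => hg' i⟩
      obtain ⟨G, h3⟩ := hshift (fun m => m / 2) _ ⟨1 / 2, 0, fun m => by ring⟩ h2.intSum
      refine ⟨G, ?_⟩
      rw [funext (laxPow_succ_left a j)]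
      exact h3

/-- The coefficients of `log L = log Λ + ∑_{j ≥ 1} laxLog a j Λ^{-j}`: the derivative at `m = 0` of
the coefficients of `L^m`. -/
def laxLog (a : ℕ → JetSeries) (j : ℕ) : JetSeries := (exists_laxPow_hasPolyDeriv a j).choose

theorem laxPow_hasPolyDeriv (a : ℕ → JetSeries) (j : ℕ) :
    SeriesHasPolyDeriv (laxPow a j) (laxLog a j) :=
  (exists_laxPow_hasPolyDeriv a j).choose_spec

theorem laxLog_zero (a : ℕ → JetSeries) : laxLog a 0 = 0 := by
  have h := laxPow_hasPolyDeriv a 0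
  rw [show (laxPow a 0) = fun _ => 1 from funext (laxPow_zero_left a)] at h
  exact h.unique (SeriesHasPolyDeriv.const 1)

theorem sum_antidiagonal_rotate_symm {U : Type} [AddCommMonoid U] (G : ℕ → ℕ → ℕ → U) (n : ℕ) :
    ∑ p ∈ antidiagonal n, ∑ q ∈ antidiagonal p.1, G q.1 q.2 p.2 =
    ∑ p ∈ antidiagonal n, ∑ q ∈ antidiagonal p.1, G q.2 p.2 q.1 :=
  (sum_antidiagonal_rotate (fun x y w => G y w x) n).symm

/-- An additive function of m is determined by its value at any nonzero k, up to multiplication by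
k. Used once for `cyclic` and once for `formTrace`, where m = k is the easy case. -/
theorem additive_zsmul {M : Type} [AddCommGroup M] (f : ℤ → M)
    (hf : ∀ m n, f (m + n) = f m + f n) (k m : ℤ) : k • f m = m • f k := by
  have h : ∀ m, f m = m • f 1 := fun m => by
    have := map_zsmul (AddMonoidHom.mk' f hf) m 1
    simpa using this
  rw [h m, h k, smul_comm]

/-! ### The cyclic cocycle -/

/-- The potential of the commutator of `∑ c_i Λ^{m-i}` and `∑ d_j Λ^{k-m-j}`: its `Λ⁰` coefficient
is `ε∂` applied to this element. -/
def cyclic (k : ℕ) (m : ℚ) (c d : ℕ → JetSeries) : JetSeries :=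
  ∑ p ∈ antidiagonal k, seriesOp (sinhSymbol (m - p.1)) (c p.1 * d p.2)

theorem seriesOp_neg (φ : PowerSeries ℚ) (f : JetSeries) : seriesOp (-φ) f = -seriesOp φ f := by
  ext1 n
  simp [coeff_seriesOp]

theorem seriesOp_zero (f : JetSeries) : seriesOp 0 f = 0 := by
  ext1 n
  simp [coeff_seriesOp]

theorem cyclic_swap {k : ℕ} {m n : ℚ} (h : m + n = k) (c d : ℕ → JetSeries) :
    cyclic k n d c = -cyclic k m c d := by
  rw [cyclic, cyclic, ← Finset.sum_neg_distrib, ← Finset.Nat.sum_antidiagonal_swap]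
  refine Finset.sum_congr rfl fun p hp => ?_
  rw [Finset.HasAntidiagonal.mem_antidiagonal] at hp
  have e : n - (p.2 : ℚ) = -(m - p.1) := by
    rw [← hp] at h
    push_cast at h
    linarith
  rw [← seriesOp_neg, ← sinhSymbol_neg, Prod.fst_swap, Prod.snd_swap, mul_comm, e]

theorem cyclic_star (k : ℕ) (m n : ℚ) (x y w : ℕ → JetSeries) :
    cyclic k (m + n) (star m n x y) w = ∑ p ∈ antidiagonal k, ∑ q ∈ antidiagonal p.1,
      seriesOp (sinhSymbol ((m - q.1) + (n - q.2)))
        (jetShift (-(n - q.2) / 2) (x q.1) * jetShift ((m - q.1) / 2) (y q.2) * w p.2) := by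
  simp only [cyclic, star, Finset.sum_mul, map_sum]
  refine Finset.sum_congr rfl fun p _ => Finset.sum_congr rfl fun q hq => ?_
  rw [Finset.HasAntidiagonal.mem_antidiagonal] at hq
  rw [← hq, Nat.cast_add, add_sub_add_comm]

/-- The potential of commutators is a cyclic cocycle, in line with [xy, w] + [yw, x] + [wx, y] = 0.
For each triple of coefficients the three summands are symbols applied to shifts of a single product
f, and the symbols cancel by `sinhSymbol_cocycle`. -/
theorem cyclic_star_add {k : ℕ} {m n p : ℚ} (h : m + n + p = k) (x y w : ℕ → JetSeries) :
    cyclic k (m + n) (star m n x y) w + cyclic k (n + p) (star n p y w) x +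
      cyclic k (p + m) (star p m w x) y = 0 := by
  rw [cyclic_star, cyclic_star, cyclic_star,
    sum_antidiagonal_rotate_symm (fun j l i => seriesOp (sinhSymbol ((n - j) + (p - l)))
      (jetShift (-(p - l) / 2) (y j) * jetShift ((n - j) / 2) (w l) * x i)),
    sum_antidiagonal_rotate (fun l i j => seriesOp (sinhSymbol ((p - l) + (m - i)))
      (jetShift (-(m - i) / 2) (w l) * jetShift ((p - l) / 2) (x i) * y j)),
    ← Finset.sum_add_distrib, ← Finset.sum_add_distrib]
  refine Finset.sum_eq_zero fun r hr => ?_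
  rw [← Finset.sum_add_distrib, ← Finset.sum_add_distrib]
  refine Finset.sum_eq_zero fun t ht => ?_
  rw [Finset.HasAntidiagonal.mem_antidiagonal] at hr ht
  obtain ⟨i, j⟩ := t
  obtain ⟨c, l⟩ := r
  dsimp only at ht hr ⊢
  have h0 : (m - i) + (n - j) + (p - l) = 0 := by
    rw [← ht] at hr
    rw [← hr] at h
    push_cast at h
    linarith
  obtain ⟨α, hα⟩ : ∃ α, α = m - i := ⟨_, rfl⟩
  obtain ⟨β, hβ⟩ : ∃ β, β = n - j := ⟨_, rfl⟩
  rw [← hα, ← hβ] at h0 ⊢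
  rw [(by linarith : p - l = -α - β)]
  set f := jetShift (-β / 2) (x i) * jetShift (α / 2) (y j) * w l with hf
  have h1 : jetShift (-(-α - β) / 2) (y j) * jetShift (β / 2) (w l) * x i = jetShift (β / 2) f := by
    rw [hf, jetShift_mul, jetShift_mul, jetShift_jetShift, jetShift_jetShift,
      (by ring : β / 2 + -β / 2 = 0), jetShift_zero,
      (by ring : β / 2 + α / 2 = -(-α - β) / 2)]
    ring
  have h2 : jetShift (-α / 2) (w l) * jetShift ((-α - β) / 2) (x i) * y j =
      jetShift (-α / 2) f := by
    rw [hf, jetShift_mul, jetShift_mul, jetShift_jetShift, jetShift_jetShift,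
      (by ring : -α / 2 + α / 2 = 0), jetShift_zero,
      (by ring : -α / 2 + -β / 2 = (-α - β) / 2)]
    ring
  rw [h1, h2, jetShift, jetShift, ← seriesOp_mul, ← seriesOp_mul, ← seriesOp_add, ← seriesOp_add]
  have h3 := sinhSymbol_cocycle (r := α) (s := β) (t := -α - β) (by ring)
  have h4 : sinhSymbol (α + β) + sinhSymbol (β + (-α - β)) * expSymbol (β / 2) +
      sinhSymbol (-α - β + α) * expSymbol (-α / 2) = 0 := by
    rw [(by ring : α + β = -(-α - β)), (by ring : β + (-α - β) = -α),
      (by ring : -α - β + α = -β), sinhSymbol_neg, sinhSymbol_neg, sinhSymbol_neg, ← neg_eq_zero,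
      ← h3]
    ring
  rw [h4, seriesOp_zero]

/-- `∑ c_i(m) c_j(k-m)` weighted as in `cyclic` vanishes, for the powers of one operator. -/
theorem cyclic_laxPow (ha : a 0 = 1) {k : ℕ} (hk : k ≠ 0) (m : ℤ) :
    cyclic k m (fun j => laxPow a j m) (fun j => laxPow a j (k - m)) = 0 := by
  set f : ℤ → JetSeries := fun m =>
    cyclic k m (fun j => laxPow a j m) (fun j => laxPow a j (k - m)) with hf
  -- That L^m and L^{k-m} commute only says that ε∂ kills this element; additivity is what excludes
  -- a nonzero constant.
  have hadd : ∀ m n, f (m + n) = f m + f n := by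
    intro m n
    have h := cyclic_star_add (k := k) (m := m) (n := n) (p := ((k - m - n : ℤ) : ℚ))
      (by push_cast; ring) (fun j => laxPow a j m) (fun j => laxPow a j n)
      (fun j => laxPow a j (k - m - n))
    rw [← laxPow_add ha, ← laxPow_add ha, ← laxPow_add ha, ← Int.cast_add, ← Int.cast_add,
      ← Int.cast_add, (by ring : n + (k - m - n) = k - m), (by ring : (k - m - n) + m = k - n),
      cyclic_swap (m := m) (n := ((k - m : ℤ) : ℚ)) (by push_cast; ring),
      cyclic_swap (m := n) (n := ((k - n : ℤ) : ℚ)) (by push_cast; ring)] at h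
    simp only [hf]
    rw [(by ring : (k : ℤ) - (m + n) = k - m - n)]
    rw [← sub_eq_zero, ← h]
    abel
  -- At m = k the second factor is L^0 = 1, and its only term is weighted by the symbol at 0, which
  -- vanishes.
  have hk0 : f k = 0 := by
    simp only [hf, cyclic, sub_self, laxPow_zero_right]
    refine Finset.sum_eq_zero fun p hp => ?_
    rw [Finset.HasAntidiagonal.mem_antidiagonal] at hp
    by_cases h2 : p.2 = 0
    · have : ((k : ℤ) : ℚ) - p.1 = 0 := by
        rw [← hp, h2]
        simp
      rw [this, sinhSymbol_zero, seriesOp_zero]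
    · rw [if_neg h2, mul_zero, map_zero]
  have := additive_zsmul f hadd k m
  rw [hk0, smul_zero, ← Int.cast_smul_eq_zsmul ℚ, smul_eq_zero] at this
  exact this.resolve_left (by exact_mod_cast hk)

theorem seriesOp_C (r : ℚ) (f : JetSeries) : seriesOp (PowerSeries.C r) f = r • f := by
  ext1 n
  rw [coeff_seriesOp, Finset.sum_eq_single (0, n)]
  · simp
  · rintro ⟨i, j⟩ hp hne
    have hi : i ≠ 0 := by
      rintro rfl
      simp at hp
      exact hne (by simp [hp])
    simp [PowerSeries.coeff_C, hi]
  · simp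

theorem seriesOp_one_right (φ : PowerSeries ℚ) :
    seriesOp φ 1 = PowerSeries.coeff 0 φ • (1 : JetSeries) := by
  -- Correcting the constant term of φ to 1 reduces to the normalized case.
  have h := seriesOp_apply_one (φ + PowerSeries.C (1 - PowerSeries.coeff 0 φ)) (by simp)
  rw [seriesOp_add, seriesOp_C, sub_smul, one_smul] at h
  rw [← sub_eq_zero, ← sub_eq_zero.2 h]
  abel

theorem cyclic_laxPow_zero (a : ℕ → JetSeries) (m : ℤ) :
    cyclic 0 m (fun j => laxPow a j m) (fun j => laxPow a j (-m)) =
      (m : ℚ) • (1 : JetSeries) := by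
  rw [cyclic, Finset.Nat.sum_antidiagonal_eq_sum_range_succ_mk, Finset.sum_range_one]
  simp only [laxPow_zero_left, Nat.cast_zero, Nat.sub_zero, sub_zero, mul_one]
  rw [seriesOp_one_right, coeff_zero_sinhSymbol]

/-- The derivative at m = 0 of `cyclic_laxPow`. The coefficients of L^m other than the leading one
vanish at m = 0, so they contribute only through their derivative, log L. The leading one is
constantly 1, and there the derivative falls on the symbol and produces c_k(k). -/
theorem cyclic_laxLog (ha : a 0 = 1) {k : ℕ} (hk : k ≠ 0) :
    laxPow a k k + cyclic k 0 (laxLog a) (fun j => laxPow a j k) = 0 := by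
  have h1 : ∀ p : ℕ × ℕ, SeriesHasPolyDeriv (fun m : ℤ =>
      seriesOp (sinhSymbol (m - p.1)) (laxPow a p.1 m * laxPow a p.2 (k - m)))
      ((if p.1 = 0 then laxPow a p.2 k else 0) +
        seriesOp (sinhSymbol (0 - p.1)) (laxLog a p.1 * laxPow a p.2 k)) := by
    intro p
    obtain ⟨G, hG⟩ := (laxPow_hasPolyDeriv a p.2).reflect k
    have h2 := (laxPow_hasPolyDeriv a p.1).mul hG
    by_cases hp : p.1 = 0
    · have h3 := sinhSymbol_hasPolyDeriv_zero.seriesOp h2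
      simp only [hp, Nat.cast_zero, sub_zero, laxPow_zero_left, laxLog_zero, zero_mul, map_zero,
        if_true, add_zero, one_mul, seriesOp_one, Int.cast_zero, sinhSymbol_zero, seriesOp_zero,
        zero_add] at h3 ⊢
      exact h3
    · obtain ⟨ψ, hψ⟩ := sinhSymbol_hasPolyDeriv (-p.1)
      have h3 := hψ.seriesOp h2
      simp only [laxPow_zero_right, hp, if_false, zero_mul, map_zero, zero_add, add_zero, sub_zero,
        Int.cast_zero, ← sub_eq_add_neg] at h3 ⊢
      simpa only [zero_sub] using h3
  have h4 := SeriesHasPolyDeriv.sum (antidiagonal k) fun p _ => h1 p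
  have h5 := h4.eq_zero fun m => cyclic_laxPow ha hk m
  rw [Finset.sum_add_distrib] at h5
  rw [cyclic, ← h5]
  congr 1
  rw [Finset.sum_eq_single (0, k)]
  · simp
  · rintro ⟨i, j⟩ hp hne
    refine if_neg ?_
    rintro rfl
    simp at hp
    exact hne (by simp [hp])
  · simp

/-! ### Traces of form-valued operators -/

/-- The class in `Ω / ∂ Ω`, for the free algebra, of the `Λ⁰` coefficient of the product of
`∑ c_i Λ^{k-m-i}` and `∑ d(d_j) Λ^{m-j}`. -/
def formTrace (k : ℕ) (c d : ℕ → JetSeries) : formsFree ⧸ LinearMap.range formsDer :=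
  Submodule.Quotient.mk (∑ p ∈ antidiagonal k, c p.1 • seriesD (d p.2))

/-- In a Λ⁰ coefficient both factors are shifted by the same amount, so modulo ∂ the shifts
disappear; hence `formTrace` contains none. -/
theorem mk_formsShift (s : ℚ) (ω : formsFree) :
    (Submodule.Quotient.mk (formsShift s ω) : formsFree ⧸ LinearMap.range formsDer) =
      Submodule.Quotient.mk ω :=
  (Submodule.Quotient.eq _).2 (formsShift_sub_mem_range s ω)

/-- The Leibniz rule for d combined with cyclicity of the trace: x d(yw) is xy dw + x dy w, and the
last w is moved to the front. Each summand is matched after one shift, which is invisible modulo ∂.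
-/
theorem formTrace_star {k : ℕ} {m n p : ℚ} (h : m + n + p = k) (x y w : ℕ → JetSeries) :
    formTrace k x (star m n y w) =
      formTrace k (star n p w x) y + formTrace k (star p m x y) w := by
  simp only [formTrace, star, map_sum, Finset.smul_sum, Finset.sum_smul, seriesD_mul, smul_add,
    Finset.sum_add_distrib, smul_smul, ← Submodule.mkQ_apply]
  simp only [map_add, map_sum]
  rw [add_comm]
  refine congrArg₂ (· + ·) ?_ ?_
  · rw [sum_antidiagonal_assoc (fun i j l => (LinearMap.range formsDer).mkQ
        ((x i * jetShift ((m - j) / 2) (w l)) • seriesD (jetShift (-(n - l) / 2) (y j)))),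
      sum_antidiagonal_rotate (fun l i j => (LinearMap.range formsDer).mkQ
        ((jetShift (-(p - i) / 2) (w l) * jetShift ((n - l) / 2) (x i)) • seriesD (y j)))]
    refine Finset.sum_congr rfl fun r hr => Finset.sum_congr rfl fun t ht => ?_
    rw [Finset.HasAntidiagonal.mem_antidiagonal] at hr ht
    rw [← ht] at hr
    rw [← hr] at h
    push_cast at h
    rw [Submodule.mkQ_apply, Submodule.mkQ_apply,
      ← mk_formsShift (-(n - r.2) / 2) ((_ * _) • seriesD (y t.2)),
      formsShift_smul, jetShift_mul, jetShift_jetShift, jetShift_jetShift, seriesD_jetShift,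
      (by ring : -(n - (r.2 : ℚ)) / 2 + (n - r.2) / 2 = 0), jetShift_zero,
      (by linarith : -(n - (r.2 : ℚ)) / 2 + -(p - t.1) / 2 = (m - t.2) / 2), mul_comm (x _)]
  · rw [sum_antidiagonal_assoc (fun i j l => (LinearMap.range formsDer).mkQ
        ((x i * jetShift (-(n - l) / 2) (y j)) • seriesD (jetShift ((m - j) / 2) (w l))))]
    refine Finset.sum_congr rfl fun r hr => Finset.sum_congr rfl fun t ht => ?_
    rw [Finset.HasAntidiagonal.mem_antidiagonal] at hr ht
    rw [← ht] at hr
    rw [← hr] at h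
    push_cast at h
    rw [Submodule.mkQ_apply, Submodule.mkQ_apply,
      ← mk_formsShift ((m - t.2) / 2) ((_ * _) • seriesD (w r.2)),
      formsShift_smul, jetShift_mul, jetShift_jetShift, jetShift_jetShift, seriesD_jetShift,
      (by ring : (m - (t.2 : ℚ)) / 2 + -(m - t.2) / 2 = 0), jetShift_zero,
      (by linarith : (m - (t.2 : ℚ)) / 2 + (p - t.1) / 2 = -(n - r.2) / 2)]

/-- The trace of L^{k-m} d(L^m) is additive in m by `formTrace_star`, and at m = k the first factor
is 1. -/
theorem formTrace_laxPow (ha : a 0 = 1) (k : ℕ) (m : ℤ) :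
    (k : ℤ) • formTrace k (fun j => laxPow a j (k - m)) (fun j => laxPow a j m) =
      m • (Submodule.Quotient.mk (seriesD (laxPow a k k)) :
        formsFree ⧸ LinearMap.range formsDer) := by
  set f : ℤ → formsFree ⧸ LinearMap.range formsDer := fun m =>
    formTrace k (fun j => laxPow a j (k - m)) (fun j => laxPow a j m) with hf
  have hadd : ∀ m n, f (m + n) = f m + f n := by
    intro m n
    have h := formTrace_star (k := k) (m := m) (n := n) (p := ((k - m - n : ℤ) : ℚ))
      (by push_cast; ring) (fun j => laxPow a j (k - m - n)) (fun j => laxPow a j m)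
      (fun j => laxPow a j n)
    rw [← laxPow_add ha, ← laxPow_add ha, ← laxPow_add ha, (by ring : n + (k - m - n) = k - m),
      (by ring : (k - m - n) + m = k - n)] at h
    simp only [hf]
    rw [(by ring : (k : ℤ) - (m + n) = k - m - n)]
    exact h
  have hk : f k = Submodule.Quotient.mk (seriesD (laxPow a k k)) := by
    simp only [hf, formTrace, sub_self, laxPow_zero_right]
    rw [Finset.sum_eq_single (0, k)]
    · simp
    · rintro ⟨i, j⟩ hp hne
      have hi : i ≠ 0 := by
        rintro rfl
        simp at hp
        exact hne (by simp [hp])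
      simp [hi]
    · simp
  rw [← hk]
  exact additive_zsmul f hadd k m

theorem formTrace_laxLog (ha : a 0 = 1) (k : ℕ) :
    (k : ℤ) • formTrace k (fun j => laxPow a j k) (laxLog a) =
      Submodule.Quotient.mk (seriesD (laxPow a k k)) := by
  have h1 : FormsHasPolyDeriv (fun m : ℤ => ∑ p ∈ antidiagonal k,
      laxPow a p.1 (k - m) • seriesD (laxPow a p.2 m))
      (∑ p ∈ antidiagonal k, laxPow a p.1 k • seriesD (laxLog a p.2)) := by
    refine FormsHasPolyDeriv.sum _ fun p _ => ?_
    obtain ⟨G, hG⟩ := (laxPow_hasPolyDeriv a p.1).reflect k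
    have h2 := FormsHasPolyDeriv.smul hG (laxPow_hasPolyDeriv a p.2).seriesD
    -- L^0 has constant coefficients, so the term in which the derivative falls on L^{k-m} drops
    -- out.
    have h3 : seriesD (laxPow a p.2 0) = 0 := by
      rw [laxPow_zero_right]
      split_ifs
      · exact seriesD_one
      · exact map_zero _
    rwa [h3, smul_zero, zero_add, sub_zero] at h2
  simp only [formTrace]
  rw [← Submodule.Quotient.mk_smul, Submodule.Quotient.eq, mem_range_formsDer]
  intro n
  rw [map_sub, map_zsmul]
  have h4 := ((h1 n).smul (k : ℚ)).sub (HasPolyDeriv.linear (formsCoeff n (seriesD (laxPow a k k))))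
  rw [← Int.cast_smul_eq_zsmul ℚ]
  -- By `formTrace_laxPow` the difference is exact for every integer m. Exact families form a
  -- subspace, so the derivative at m = 0 is exact as well.
  refine h4.mem famExact fun m => ?_
  have h5 := formTrace_laxPow ha k m
  simp only [formTrace] at h5
  rw [← Submodule.Quotient.mk_smul, ← Submodule.Quotient.mk_smul, Submodule.Quotient.eq,
    mem_range_formsDer] at h5
  have h6 := h5 n
  rw [map_sub, map_zsmul, map_zsmul, ← Int.cast_smul_eq_zsmul ℚ, ← Int.cast_smul_eq_zsmul ℚ] at h6
  exact h6

/-! ### The explicit form of `L - K` in the free algebra -/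

/-- The constants `z_k / k`. -/
def zDiv (k : ℕ) : Const := if k = 0 then 0 else algebraMap ℚ Const (1 / k) * z k

theorem natCast_mul_zDiv {k : ℕ} (hk : k ≠ 0) : (k : Const) * zDiv k = z k := by
  rw [zDiv, if_neg hk, ← mul_assoc, ← map_natCast (algebraMap ℚ Const), ← map_mul,
    mul_one_div_cancel (by exact_mod_cast hk), map_one, one_mul]

/-- The coefficients of `τ (log L - log Λ) + ∑_{k ≥ 1} (z_k / k) L^{-k}`. -/
def laxTail (a : ℕ → JetSeries) (j : ℕ) : JetSeries :=
  tau • laxLog a j + ∑ r ∈ antidiagonal j, zDiv r.2 • laxPow a r.1 (-r.2)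

theorem laxTail_zero (a : ℕ → JetSeries) : laxTail a 0 = 0 := by
  rw [laxTail, laxLog_zero, Finset.Nat.sum_antidiagonal_eq_sum_range_succ_mk]
  simp [zDiv]

/-- This is, up to sign, `cyclic` on (L^{-l}, L^{k+l}), of total degree k: zero by `cyclic_laxPow`
unless k = 0, when it is -l by `cyclic_laxPow_zero`. -/
theorem cyclic_neg_laxPow (ha : a 0 = 1) (k l : ℕ) :
    ∑ q ∈ antidiagonal k, seriesOp (sinhSymbol ((q.2 + l : ℕ) : ℚ))
      (laxPow a q.2 (-l) * laxPow a q.1 ((k + l : ℕ) : ℤ)) =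
      if k = 0 then (l : ℚ) • (1 : JetSeries) else 0 := by
  have h : cyclic k ((-l : ℤ) : ℚ) (fun j => laxPow a j (-l)) (fun j => laxPow a j (k - -l)) =
      -∑ q ∈ antidiagonal k, seriesOp (sinhSymbol ((q.2 + l : ℕ) : ℚ))
      (laxPow a q.2 (-l) * laxPow a q.1 ((k + l : ℕ) : ℤ)) := by
    rw [cyclic, ← Finset.Nat.sum_antidiagonal_swap, ← Finset.sum_neg_distrib]
    refine Finset.sum_congr rfl fun q _ => ?_
    rw [← seriesOp_neg, ← sinhSymbol_neg, Prod.fst_swap, Prod.snd_swap]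
    push_cast
    rw [(by ring : -(l : ℚ) - q.2 = -(q.2 + l)), sub_neg_eq_add]
  rw [← neg_inj, ← h]
  split_ifs with hk
  · subst hk
    have := cyclic_laxPow_zero a (-l)
    simp only [neg_neg] at this
    simp only [Nat.cast_zero, zero_sub, neg_neg, this]
    simp
  · rw [cyclic_laxPow ha hk, neg_zero]

/-- The logarithm contributes τ c_k(k) by `cyclic_laxLog`. Among the L^{-l} with l ≤ k only l = k
pairs nontrivially with L^k, and it contributes k · z_k/k = z_k. -/
theorem laxTail_equation (ha : a 0 = 1) {k : ℕ} (hk : k ≠ 0) :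
    ∑ p ∈ antidiagonal k, seriesOp (sinhSymbol p.1) (laxTail a p.1 * laxPow a p.2 k) =
      z k • (1 : JetSeries) + tau • laxPow a k k := by
  have h1 : ∑ p ∈ antidiagonal k, seriesOp (sinhSymbol p.1) (laxLog a p.1 * laxPow a p.2 k) =
      laxPow a k k := by
    have h := cyclic_laxLog ha hk
    rw [cyclic] at h
    rw [eq_neg_of_add_eq_zero_left h, ← Finset.sum_neg_distrib]
    refine Finset.sum_congr rfl fun p _ => ?_
    rw [← seriesOp_neg, zero_sub, sinhSymbol_neg, neg_neg]
  simp only [laxTail, add_mul, map_add, Finset.sum_add_distrib, smul_mul_assoc, map_smul,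
    Finset.sum_mul, map_sum]
  rw [← Finset.smul_sum, h1, add_comm]
  congr 1
  have h2 : ∑ p ∈ antidiagonal k, ∑ r ∈ antidiagonal p.1, zDiv r.2 •
      seriesOp (sinhSymbol p.1) (laxPow a r.1 (-r.2) * laxPow a p.2 k) =
      ∑ p ∈ antidiagonal k, ∑ r ∈ antidiagonal p.1, zDiv r.2 •
      seriesOp (sinhSymbol ((r.1 + r.2 : ℕ) : ℚ)) (laxPow a r.1 (-r.2) * laxPow a p.2 k) := by
    refine Finset.sum_congr rfl fun p _ => Finset.sum_congr rfl fun r hr => ?_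
    rw [Finset.HasAntidiagonal.mem_antidiagonal] at hr
    rw [hr]
  -- Regroup so that the inner sum, for each fixed l, is the pairing of L^{-l} with L^k.
  rw [h2, sum_antidiagonal_rotate_symm (fun i l j => zDiv l •
      seriesOp (sinhSymbol ((i + l : ℕ) : ℚ)) (laxPow a i (-l) * laxPow a j k)) k]
  have h3 : ∀ p ∈ antidiagonal k, ∑ q ∈ antidiagonal p.1, zDiv p.2 •
      seriesOp (sinhSymbol ((q.2 + p.2 : ℕ) : ℚ)) (laxPow a q.2 (-p.2) * laxPow a q.1 k) =
      zDiv p.2 • if p.1 = 0 then (p.2 : ℚ) • (1 : JetSeries) else 0 := by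
    intro p hp
    rw [Finset.HasAntidiagonal.mem_antidiagonal] at hp
    rw [← Finset.smul_sum, ← cyclic_neg_laxPow ha, hp]
  rw [Finset.sum_congr rfl h3, Finset.sum_eq_single (0, k)]
  · dsimp only
    rw [if_pos rfl, ← natCast_mul_zDiv hk, mul_comm, mul_smul]
    congr 1
    rw [Nat.cast_smul_eq_nsmul, Nat.cast_smul_eq_nsmul]
  · rintro ⟨i, j⟩ hp hne
    have hi : i ≠ 0 := by
      rintro rfl
      simp at hp
      exact hne (by simp [hp])
    simp [hi]
  · simp

/-! ### Evaluation of the traces against L^n -/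

/-- The class of `d(c_k(k)) / k` in `Ω / ∂ Ω` for the free algebra. -/
def powerForm (a : ℕ → JetSeries) (k : ℕ) : formsFree ⧸ LinearMap.range formsDer :=
  algebraMap ℚ Const (1 / k) • Submodule.Quotient.mk (seriesD (laxPow a k k))

/-- Here 1/0 = 0. Since the index k corresponds to h_{k-1}, this agrees with the convention h_{-1} =
0. -/
theorem powerForm_zero (a : ℕ → JetSeries) : powerForm a 0 = 0 := by
  simp [powerForm]

theorem eq_of_natCast_smul {M : Type} [AddCommGroup M] [Module Const M] {k : ℕ} (hk : k ≠ 0)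
    {m : ℤ} {x y : M} (h : (k : ℤ) • x = m • y) :
    x = (m : Const) • algebraMap ℚ Const (1 / k) • y := by
  rw [smul_comm, Int.cast_smul_eq_zsmul, ← h, natCast_zsmul, ← Nat.cast_smul_eq_nsmul Const,
    smul_smul, ← map_natCast (algebraMap ℚ Const), ← map_mul,
    one_div_mul_cancel (by exact_mod_cast hk), map_one, one_smul]

theorem formTrace_zero (c d : ℕ → JetSeries) (hd : seriesD (d 0) = 0) : formTrace 0 c d = 0 := by
  rw [formTrace, Finset.Nat.sum_antidiagonal_eq_sum_range_succ_mk, Finset.sum_range_one, hd,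
    smul_zero]
  rfl

theorem formTrace_laxPow_eq (ha : a 0 = 1) (k : ℕ) (m : ℤ) :
    formTrace k (fun j => laxPow a j (k - m)) (fun j => laxPow a j m) =
      (m : Const) • powerForm a k := by
  by_cases hk : k = 0
  · subst hk
    rw [powerForm_zero, smul_zero, formTrace_zero]
    rw [laxPow_zero_left, seriesD_one]
  · exact eq_of_natCast_smul hk (formTrace_laxPow ha k m)

theorem formTrace_laxLog_eq (ha : a 0 = 1) (k : ℕ) :
    formTrace k (fun j => laxPow a j k) (laxLog a) = powerForm a k := by
  by_cases hk : k = 0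
  · subst hk
    rw [powerForm_zero, formTrace_zero]
    rw [laxLog_zero, map_zero]
  · have := eq_of_natCast_smul hk (m := 1) ((formTrace_laxLog ha k).trans (one_smul ℤ _).symm)
    rwa [Int.cast_one, one_smul] at this

/-- Differentiating L^{-l} brings down the factor -l, which turns z_l/l into -z_l. -/
theorem formTrace_laxTail (ha : a 0 = 1) (n : ℕ) :
    formTrace n (fun j => laxPow a j n) (laxTail a) =
      tau • powerForm a n -
        ∑ p ∈ antidiagonal n, (if p.2 = 0 then 0 else z p.2) • powerForm a p.1 := by
  have h1 : formTrace n (fun j => laxPow a j n) (laxTail a) =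
      tau • formTrace n (fun j => laxPow a j n) (laxLog a) +
        ∑ p ∈ antidiagonal n, zDiv p.2 • formTrace p.1 (fun j => laxPow a j n)
          (fun j => laxPow a j (-p.2)) := by
    simp only [formTrace, ← Submodule.mkQ_apply, map_sum, laxTail, map_add, smul_add,
      Finset.sum_add_distrib, map_smul, Finset.smul_sum, smul_comm _ (_ : Const)]
    refine congrArg₂ (· + ·) rfl ?_
    exact sum_antidiagonal_assoc (fun i j l => zDiv l • (LinearMap.range formsDer).mkQ
      (laxPow a i n • seriesD (laxPow a j (-l)))) n
  rw [h1, formTrace_laxLog_eq ha, sub_eq_add_neg, ← Finset.sum_neg_distrib]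
  refine congrArg₂ (· + ·) rfl (Finset.sum_congr rfl fun p hp => ?_)
  rw [Finset.HasAntidiagonal.mem_antidiagonal] at hp
  have h2 := formTrace_laxPow_eq ha p.1 (-p.2)
  rw [(by omega : (p.1 : ℤ) - -p.2 = n)] at h2
  rw [h2, smul_smul]
  split_ifs with h
  · simp [zDiv, h]
  · rw [← natCast_mul_zDiv h, ← neg_smul]
    push_cast
    congr 1
    ring

/-! ### Passage to the Toda algebra -/

/-- The projection from the free algebra. -/
def toToda : JetSeries →+* Toda := Ideal.Quotient.mk relIdeal

theorem toToda_seriesOp (φ : PowerSeries ℚ) (f : JetSeries) :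
    toToda (seriesOp φ f) = op φ (toToda f) := rfl

theorem toToda_jetShift (s : ℚ) (f : JetSeries) :
    toToda (jetShift s f) = shift s (toToda f) := rfl

theorem toToda_smul (c : Const) (f : JetSeries) : toToda (c • f) = c • toToda f := rfl

/-- A lift of the sequence `1, a_1, a_2, …` of coefficients of the Lax operator. -/
def laxLift (k : ℕ) : JetSeries :=
  if k = 0 then 1 else (Ideal.Quotient.mk_surjective (I := relIdeal) (laxCoeff k)).choose

theorem laxLift_zero : laxLift 0 = 1 := if_pos rfl

theorem toToda_laxLift {k : ℕ} (hk : k ≠ 0) : toToda (laxLift k) = laxCoeff k := by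
  rw [laxLift, if_neg hk]
  exact (Ideal.Quotient.mk_surjective (I := relIdeal) (laxCoeff k)).choose_spec

theorem coeff_lax (i : ℕ) : lax.coeff (1 - i) = toToda (laxLift i) := by
  by_cases hi : i = 0
  · subst hi
    rw [laxLift_zero, map_one]
    exact ofLower_one _
  · rw [toToda_laxLift hi, lax, ofLower_of_le _ (by omega),
      (by omega : (1 - (1 - (i : ℤ))).toNat = i)]

/-- L has no terms above Λ and L^n none above Λ^n, so the sum over ℤ defining the product collapses
to a finite convolution. -/
theorem coeff_lax_pow (n j : ℕ) : (lax ^ n).coeff (n - j) = toToda (laxPow laxLift j n) := by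
  induction n generalizing j with
  | zero =>
    rw [coeff_pow_zero, Nat.cast_zero, laxPow_zero_right]
    by_cases hj : j = 0
    · simp [hj]
    · rw [if_neg (by omega), if_neg hj, map_zero]
  | succ n ih =>
    rw [coeff_pow_succ, Nat.cast_succ, laxPow_add_one laxLift_zero, star, map_sum,
      finsum_eq_sum_of_support_subset (s := (antidiagonal j).image fun p => 1 - (p.1 : ℤ)),
      Finset.sum_image]
    · refine Finset.sum_congr rfl fun p hp => ?_
      rw [Finset.HasAntidiagonal.mem_antidiagonal] at hp
      rw [map_mul, toToda_jetShift, toToda_jetShift, coeff_lax,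
        (by omega : (n : ℤ) + 1 - j - (1 - p.1) = n - p.2), ih]
      push_cast
      rfl
    · rintro ⟨i, l⟩ hp ⟨i', l'⟩ hp' h
      simp only [Finset.mem_coe, Finset.HasAntidiagonal.mem_antidiagonal] at hp hp' h
      ext <;> dsimp only <;> omega
    · intro i hi
      simp only [Finset.coe_image, Set.mem_image, Finset.mem_coe,
        Finset.HasAntidiagonal.mem_antidiagonal]
      by_contra h
      refine hi ?_
      dsimp only
      by_cases h1 : 1 < i
      · rw [lax, ofLower_of_gt _ h1, map_zero, zero_mul]
      · rw [lax, coeff_ofLower_pow_of_gt _ n, map_zero, mul_zero]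
        by_contra h2
        exact h ⟨((1 - i).toNat, j - (1 - i).toNat), by dsimp only; omega, by dsimp only; omega⟩

theorem op_algebraMap (φ : PowerSeries ℚ) (hφ : PowerSeries.coeff 0 φ = 1) (c : Const) :
    op φ (algebraMap Const Toda c) = algebraMap Const Toda c := by
  rw [Algebra.algebraMap_eq_smul_one, map_smul, op_apply_one φ hφ]

theorem op_nablaSymbol_opP (f : Toda) : op nablaSymbol (opP f) = f := by
  rw [opP, ← op_mul, pSymbol, PowerSeries.mul_inv_cancel, op_one]
  rw [← PowerSeries.coeff_zero_eq_constantCoeff_apply, ← sinhSymbol_one, coeff_zero_sinhSymbol]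
  exact one_ne_zero

theorem op_zero (f : Toda) : op 0 f = 0 := by
  simpa using op_add 0 0 f

/-- The coefficients of `L - K`, starting from `Λ⁰`. -/
def laxSubK (j : ℕ) : Toda :=
  if j = 0 then 0 else laxCoeff (j + 1) - if j = 1 then q else 0

theorem toToda_laxLift_succ (j : ℕ) : toToda (laxLift (j + 1)) =
    laxSubK j + ((if j = 0 then v else 0) + if j = 1 then q else 0) := by
  rw [toToda_laxLift (by omega), laxSubK]
  rcases j with _ | _ | j <;> simp [laxCoeff_one]

theorem laxPow_one (j : ℕ) : laxPow laxLift j 1 = laxLift j := by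
  have h := laxPow_add_one laxLift_zero 0 j
  simp only [laxPow_zero_right, Int.cast_zero, star_one_right, zero_add] at h
  exact h

/-- The defining equations of L become linear in L - K once L^k is regarded as given: both p_{-1}(k)
and q p_1(k), after ∇/∂, are pairings with L^k. -/
theorem laxSubK_equation {k : ℕ} (hk : k ≠ 0) :
    ∑ p ∈ antidiagonal k, op (sinhSymbol p.1) (laxSubK p.1 * toToda (laxPow laxLift p.2 k)) =
      toToda (z k • (1 : JetSeries) + tau • laxPow laxLift k k) := by
  -- The pair (L, L^k) has total degree k + 1. The leading term Λ of L meets the coefficient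
  -- p_{-1}(k), with weight ∇/∂.
  have h1 := cyclic_laxPow laxLift_zero (Nat.succ_ne_zero k) 1
  rw [cyclic, Finset.Nat.sum_antidiagonal_succ] at h1
  simp only [laxPow_one, laxLift_zero, one_mul, Nat.cast_succ, add_sub_cancel_right, Nat.cast_zero,
    sub_zero, Int.cast_one] at h1
  have h2 := congrArg toToda h1
  rw [map_add, map_sum, map_zero] at h2
  have h3 : op nablaSymbol (toToda (laxPow laxLift (k + 1) k)) =
      ∑ p ∈ antidiagonal k, op (sinhSymbol p.1) (toToda (laxLift (p.1 + 1)) *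
        toToda (laxPow laxLift p.2 k)) := by
    rw [← sinhSymbol_one, ← toToda_seriesOp, eq_neg_of_add_eq_zero_left h2,
      ← Finset.sum_neg_distrib]
    refine Finset.sum_congr rfl fun p _ => ?_
    rw [← map_neg, ← seriesOp_neg, ← sinhSymbol_neg, toToda_seriesOp, map_mul,
      (by ring : -(1 - ((p.1 : ℚ) + 1)) = p.1)]
  -- This is the pairing of v + q Λ^{-1} with L^k: v carries the symbol at 0, which vanishes, and q
  -- the symbol at 1, which is ∇/∂.
  have h4 : op nablaSymbol (q * toToda (laxPow laxLift (k - 1) k)) =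
      ∑ p ∈ antidiagonal k, op (sinhSymbol p.1) (((if p.1 = 0 then v else 0) +
        if p.1 = 1 then q else 0) * toToda (laxPow laxLift p.2 k)) := by
    rw [Finset.sum_eq_single (1, k - 1)]
    · simp [sinhSymbol_one]
    · rintro ⟨i, j⟩ hp hne
      rw [Finset.HasAntidiagonal.mem_antidiagonal] at hp
      dsimp only at hp ⊢
      by_cases hi : i = 0
      · rw [hi, Nat.cast_zero, sinhSymbol_zero, op_zero]
      · have hi1 : i ≠ 1 := by
          rintro rfl
          exact hne (by ext <;> dsimp only; omega)
        rw [if_neg hi, if_neg hi1, add_zero, zero_mul, map_zero]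
    · intro h
      exact absurd (Finset.HasAntidiagonal.mem_antidiagonal.2 (by dsimp only; omega)) h
  have h5 := motion_lax k (by omega)
  rw [motion, (by push_cast; ring : (-1 : ℤ) = k - (k + 1 : ℕ)), coeff_lax_pow,
    (by omega : (1 : ℤ) = k - (k - 1 : ℕ)), coeff_lax_pow,
    (by ring : (0 : ℤ) = k - k), coeff_lax_pow] at h5
  -- ∇/∂ undoes P and fixes the constant z_k.
  have h6 := congrArg (op nablaSymbol) h5
  rw [map_sub, map_sub, map_smul, op_nablaSymbol_opP, h3, h4, ← Finset.sum_sub_distrib,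
    op_algebraMap _ (by rw [← sinhSymbol_one, coeff_zero_sinhSymbol])] at h6
  rw [map_add, toToda_smul, toToda_smul, map_one, ← Algebra.algebraMap_eq_smul_one, ← h6,
    sub_add_cancel]
  refine Finset.sum_congr rfl fun p _ => ?_
  rw [← map_sub, ← sub_mul, toToda_laxLift_succ, add_sub_cancel_right]

/-- `L - K = τ (log L - log Λ) + ∑_{k ≥ 1} (z_k / k) L^{-k}`. -/
theorem laxSubK_eq (j : ℕ) : laxSubK j = toToda (laxTail laxLift j) := by
  induction j using Nat.strong_induction_on with
  | _ k ih =>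
    by_cases hk : k = 0
    · rw [hk, laxTail_zero, map_zero]
      rfl
    have h1 := laxSubK_equation hk
    -- Both sequences solve the same system. By induction all terms with index below k cancel,
    -- leaving the k-th difference times c_0(k) = 1, under a symbol with constant term k ≠ 0, hence
    -- invertible.
    rw [← laxTail_equation laxLift_zero hk, map_sum, ← sub_eq_zero, ← Finset.sum_sub_distrib,
      Finset.sum_eq_single (k, 0)] at h1
    · rw [toToda_seriesOp, ← map_sub, map_mul, ← sub_mul, laxPow_zero_left, map_one, mul_one] at h1
      have h2 := congrArg (op (sinhSymbol k)⁻¹) h1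
      rw [← op_mul, PowerSeries.inv_mul_cancel, op_one, map_zero] at h2
      · exact sub_eq_zero.1 h2
      · rw [← PowerSeries.coeff_zero_eq_constantCoeff_apply, coeff_zero_sinhSymbol]
        exact_mod_cast hk
    · rintro ⟨i, l⟩ hp hne
      rw [Finset.HasAntidiagonal.mem_antidiagonal] at hp
      dsimp only at hp ⊢
      have hi : i < k := by
        rcases Nat.eq_zero_or_pos l with rfl | hl
        · exact absurd (by rw [← hp, add_zero]) hne
        · omega
      rw [toToda_seriesOp, map_mul toToda, ih i hi, sub_self]
    · simp

/-! ### Descent of forms to Ω and the final computation -/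

/-- The projection of forms of the free algebra to `Ω`. -/
def toForms : formsFree →ₗ[Const] Forms where
  toFun := Submodule.Quotient.mk (p := formsRel)
  map_add' _ _ := rfl
  map_smul' _ _ := rfl

theorem toForms_smul (f : JetSeries) (ω : formsFree) :
    toForms (f • ω) = toToda f • toForms ω := rfl

theorem toForms_seriesD (f : JetSeries) : toForms (seriesD f) = dForm (toToda f) := rfl

/-- The map induced on classes of forms modulo `∂`. -/
def toFormFunctional : (formsFree ⧸ LinearMap.range formsDer) →ₗ[Const] FormFunctional :=
  Submodule.mapQ _ _ toForms (by
    rintro _ ⟨ω, rfl⟩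
    exact ⟨toForms ω, rfl⟩)

theorem toFormFunctional_mk (ω : formsFree) :
    toFormFunctional (Submodule.Quotient.mk ω) = Submodule.Quotient.mk (toForms ω) := rfl

theorem toFormFunctional_powerForm (n : ℕ) :
    toFormFunctional (powerForm laxLift (n + 1)) = dFunctional (h n) := by
  have h1 := coeff_lax_pow (n + 1) (n + 1)
  rw [sub_self] at h1
  rw [powerForm, h, map_smul, map_smul, residue, h1, Nat.cast_succ]
  rfl

theorem formShift_smul (s : ℚ) (f : Toda) (ω : Forms) :
    formShift s (f • ω) = shift s f • formShift s ω := by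
  induction f using Submodule.Quotient.induction_on with
  | H f =>
    induction ω using Submodule.Quotient.induction_on with
    | H ω => exact congrArg toForms (formsShift_smul s f ω)

theorem mk_formShift (s : ℚ) (ω : Forms) :
    (Submodule.Quotient.mk (formShift s ω) : FormFunctional) = Submodule.Quotient.mk ω := by
  induction ω using Submodule.Quotient.induction_on with
  | H ω => exact congrArg toFormFunctional (mk_formsShift s ω)

theorem dForm_one : dForm 1 = 0 := by
  have := congrArg toForms seriesD_one
  rwa [toForms_seriesD, map_one, map_zero] at this

theorem opK_coeff_eq_zero {j : ℤ} (h1 : j ≠ 1) (h0 : j ≠ 0) (h : j ≠ -1) : opK.coeff j = 0 := by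
  simp [opK, h1, h0, h]

/-- The residue of `L^n dK`. -/
theorem formResidue_mul_opK (n : ℕ) : formResidue (lax ^ n * opK.d) =
    Submodule.Quotient.mk ((lax ^ n).coeff 0 • dForm v + (lax ^ n).coeff 1 • dForm q) := by
  have h1 : (lax ^ n * opK.d).coeff 0 = formShift 0 ((lax ^ n).coeff 0 • dForm v) +
      formShift (1 / 2) ((lax ^ n).coeff 1 • dForm q) := by
    change ∑ᶠ i : ℤ, shift (-((0 - i : ℤ) : ℚ) / 2) ((lax ^ n).coeff i) •
      formShift ((i : ℚ) / 2) (dForm (opK.coeff (0 - i))) = _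
    rw [finsum_eq_sum_of_support_subset (s := {0, 1}), Finset.sum_pair (by norm_num),
      formShift_smul, formShift_smul]
    · have hv : opK.coeff (0 - 0) = v := rfl
      have hq : opK.coeff (0 - 1) = q := rfl
      rw [hv, hq]
      norm_num
    · intro i hi
      by_contra h
      simp only [Finset.coe_insert, Finset.coe_singleton, Set.mem_insert_iff,
        Set.mem_singleton_iff, not_or] at h
      refine hi ?_
      dsimp only
      -- The term Λ of K has constant coefficient 1, so its differential vanishes.
      by_cases hi1 : i = -1
      · have : opK.coeff (0 - i) = 1 := by
          rw [hi1]
          rfl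
        rw [this, dForm_one, map_zero, smul_zero]
      · rw [opK_coeff_eq_zero (by omega) (by omega) (by omega), map_zero, map_zero, smul_zero]
  rw [formResidue, h1, Submodule.Quotient.mk_add, Submodule.Quotient.mk_add, mk_formShift,
    mk_formShift]

/-- dK = dL - d(L - K). The first trace has total degree n + 1 because L starts at Λ, the second
total degree n because L - K is indexed from Λ⁰. -/
theorem formResidue_mul_opK_eq (n : ℕ) : formResidue (lax ^ n * opK.d) =
    toFormFunctional (formTrace (n + 1) (fun j => laxPow laxLift j n) laxLift) -
      toFormFunctional (formTrace n (fun j => laxPow laxLift j n) (laxTail laxLift)) := by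
  rw [formResidue_mul_opK, formTrace, formTrace, toFormFunctional_mk, toFormFunctional_mk, map_sum,
    map_sum, Finset.Nat.sum_antidiagonal_succ', ← Submodule.Quotient.mk_sub]
  congr 1
  simp only [toForms_smul, toForms_seriesD, laxLift_zero, map_one, dForm_one, smul_zero,
    toToda_laxLift_succ, map_add, smul_add, Finset.sum_add_distrib, ← laxSubK_eq]
  rw [zero_add, add_sub_cancel_left]
  have h0 := coeff_lax_pow n n
  rw [sub_self] at h0
  refine congrArg₂ (· + ·) ?_ ?_
  · rw [Finset.sum_eq_single (n, 0), if_pos rfl, h0]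
    · rintro ⟨i, j⟩ hp hne
      rw [Finset.HasAntidiagonal.mem_antidiagonal] at hp
      rw [if_neg, map_zero, smul_zero]
      rintro rfl
      exact hne (by rw [← hp, add_zero])
    · simp
  · cases n with
    -- L^0 has no Λ¹ coefficient and the sum contains no index 1, so both sides are zero.
    | zero =>
      rw [lax, coeff_ofLower_pow_of_gt _ 0 (by norm_num), zero_smul,
        Finset.Nat.sum_antidiagonal_eq_sum_range_succ_mk, Finset.sum_range_one, if_neg (by simp),
        map_zero, smul_zero]
    | succ n =>
      have h1 := coeff_lax_pow (n + 1) n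
      rw [(by push_cast; ring : ((n + 1 : ℕ) : ℤ) - n = 1)] at h1
      rw [Finset.sum_eq_single (n, 1), if_pos rfl, h1]
      · rintro ⟨i, j⟩ hp hne
        rw [Finset.HasAntidiagonal.mem_antidiagonal] at hp
        rw [if_neg, map_zero, smul_zero]
        rintro rfl
        exact hne (Prod.ext (Nat.add_right_cancel hp) rfl)
      · simp

theorem formResidue_lax_pow_mul_opK (n : ℕ) : formResidue (lax ^ n * opK.d) =
    dFunctional (hamiltonian n) := by
  have h1 := formTrace_laxPow_eq laxLift_zero (n + 1) 1
  simp only [laxPow_one, Nat.cast_succ, add_sub_cancel_right, Int.cast_one, one_smul] at h1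
  rw [formResidue_mul_opK_eq, h1, formTrace_laxTail laxLift_zero, map_sub, map_smul, map_sum,
    toFormFunctional_powerForm]
  cases n with
  | zero =>
    simp [powerForm_zero, hamiltonian]
  | succ n =>
    rw [hamiltonian, map_add, map_sub, map_smul, toFormFunctional_powerForm, map_sum, ← sub_add]
    refine congrArg₂ (· + ·) rfl ?_
    rw [← Finset.Nat.sum_antidiagonal_swap, Finset.Nat.sum_antidiagonal_eq_sum_range_succ_mk]
    -- The two end terms vanish: index 0 carries no z, and the top index involves `powerForm` at 0,
    -- that is h_{-1}.
    rw [Finset.sum_range_succ', Finset.sum_range_succ]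
    simp only [Prod.fst_swap, Prod.snd_swap, Nat.succ_ne_zero, if_false, if_true, zero_smul,
      map_zero, add_zero, Nat.sub_self, powerForm_zero, smul_zero]
    refine Finset.sum_nbij' (· + 1) (· - 1) ?_ ?_ ?_ ?_ ?_
    · intro i hi
      rw [Finset.mem_range] at hi
      exact Finset.mem_Icc.2 ⟨by omega, by omega⟩
    · intro i hi
      rw [Finset.mem_Icc] at hi
      exact Finset.mem_range.2 (by omega)
    · intro i _
      exact Nat.add_sub_cancel i 1
    · intro i hi
      rw [Finset.mem_Icc] at hi
      exact Nat.sub_add_cancel hi.1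
    · intro i hi
      rw [Finset.mem_range] at hi
      rw [map_smul, map_smul, (by omega : n + 1 - (i + 1) = n - (i + 1) + 1),
        toFormFunctional_powerForm]

end EquivariantToda

end

theorem mainTheorem3 (n : ℕ) :
    EquivariantToda.formResidue (EquivariantToda.lax ^ n * EquivariantToda.opK.d) =
      EquivariantToda.dFunctional (EquivariantToda.hamiltonian n) :=
  EquivariantToda.formResidue_lax_pow_mul_opK n
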